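/- Sets are subsets of $\mathbb{N}$; $A\oplus B=\{2n: n\in A\}\cup\{2n+1: n\in B\}$, $\overline{A}=\mathbb{N}\setminus A$, $X^{(n)}$ is the $n$-th Turing jump of $X$. $\leq_e$ and $\equiv_e$ denote enumeration reducibility and equivalence, and $\deg_e(X)$ denotes the enumeration degree of $X$ in the partial order $\mathcal{D}_e$ of enumeration degrees. A set $X$ is total if $\overline{X}\leq_e X$, and a degree is total if it contains a total set. A degree $\mathbf{b}$ is a strong quasiminimal cover of $\mathbf{a}$ if $\mathbf{a}<\mathbf{b}$ and every total degree $\mathbf{c}\leq\mathbf{b}$ satisfies $\mathbf{c}\leq\mathbf{a}$. A set $G$ is $A$-generic if for every set $W\subseteq 2^{<\omega}$ with $W\leq_e A\oplus\overline{A}$ some initial segment $\sigma$ of $G$ is in $W$ or has no extension in $W$. A function $g\colon\mathcal{P}(\mathbb{N})\times\mathcal{P}(\mathbb{N})\to\mathcal{P}(\mathbb{N})$ is arithmetical if for all $X,Y\subseteq\mathbb{N}$ there is $n\in\mathbb{N}$ with $g(X,Y)\leq_T (X\oplus Y)^{(n)}$. **Theorem.** There are an assignment $A\mapsto M_A$ from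 $\mathcal{P}(\mathbb{N})$ to $\mathcal{P}(\mathbb{N})$ and an arithmetical function $g\colon\mathcal{P}(\mathbb{N})\times\mathcal{P}(\mathbb{N})\to\mathcal{P}(\mathbb{N})$ such that: 1. for every $A$ there is an $A$-generic set $G_A$ with $M_A=(A\oplus\overline{A})\oplus G_A$; 2. for every $A$, $\deg_e(M_A)$ is a strong quasiminimal cover of $\deg_e(A\oplus\overline{A})$; 3. if $A\neq B$, then $M_A\not\equiv_e M_B$; 4. $g(A,C)=M_{A\oplus C}$ and $g(A,C)\leq_T (A\oplus C)^{(4)}$ for all $A,C\subseteq\mathbb{N}$; 5. for every $A$, the class $\mathcal{C}(A)=\{\deg_e(g(A,C)) : C\subseteq\mathbb{N}\}$ is cofinal in $\mathcal{D}_e$; 6. if $A\neq B$, then $\mathcal{C}(A)\cap\mathcal{C}(B)=\varnothing$. -/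

import Mathlib

namespace EnumDeg

open Nat.Partrec (Code)

/-! ### Enumeration reducibility -/

/-- The finite set with index `u`: the set of entries of the list of natural numbers coded by `u`.
Every finite set has an index, and the list of its elements is computable from the index. -/
def finSet (u : ℕ) : Set ℕ := {k | k ∈ Denumerable.ofNat (List ℕ) u}

/-- The set `Γ(B)` that the enumeration operator `Γ` (a set of axioms `⟨n, D⟩`) produces from `B`. -/
def enumOp (Γ B : Set ℕ) : Set ℕ := {n | ∃ u, Nat.pair n u ∈ Γ ∧ finSet u ⊆ B}

/-- `A ≤ₑ B`: there is a c.e. set `Γ` with `A = Γ(B)`. -/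
def EnumReducible (A B : Set ℕ) : Prop :=
  ∃ Γ : Set ℕ, REPred (fun n => n ∈ Γ) ∧ A = enumOp Γ B

/-- `A ≡ₑ B`. -/
def EnumEquiv (A B : Set ℕ) : Prop := EnumReducible A B ∧ EnumReducible B A

/-- The join `A ⊕ B = {2n | n ∈ A} ∪ {2n + 1 | n ∈ B}`. -/
def setJoin (A B : Set ℕ) : Set ℕ :=
  {n | (n % 2 = 0 ∧ n / 2 ∈ A) ∨ (n % 2 = 1 ∧ n / 2 ∈ B)}

/-- The `e`-th c.e. set `W_e`: the domain of the `e`-th partial recursive function. -/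
def ceSet (e : ℕ) : Set ℕ := {n | ((Denumerable.ofNat Code e).eval n).Dom}

/-! ### Turing reducibility and the Turing jump -/

open Classical in
/-- The characteristic function of `A`, as an oracle. -/
noncomputable def charFun (A : Set ℕ) : ℕ →. ℕ := fun n => Part.some (if n ∈ A then 1 else 0)

/-- `A ≤_T B` for sets of natural numbers. -/
def SetTuringReducible (A B : Set ℕ) : Prop := TuringReducible (charFun A) (charFun B)

/-- The `e`-th set that is c.e. in the (total) oracle `A`: the `e`-th enumeration operator applied to
`A ⊕ Aᶜ`. That these are exactly the domains of the partial functions computable with oracle `A` is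
proved in `exists_dom_iff_ceSetIn` below. -/
def ceSetIn (A : Set ℕ) (e : ℕ) : Set ℕ := enumOp (ceSet e) (setJoin A Aᶜ)

/-- The Turing jump of `A`: the halting set `{⟨e, n⟩ | n ∈ W_e^A}` relative to `A`. -/
def jump (A : Set ℕ) : Set ℕ := {p | p.unpair.2 ∈ ceSetIn A p.unpair.1}

/-- The `n`-th Turing jump `A^(n)`. -/
def iterJump (n : ℕ) (A : Set ℕ) : Set ℕ := jump^[n] A

/-- `g` is arithmetical: for all `X`, `Y` there is `n` with `g(X, Y) ≤_T (X ⊕ Y)^(n)`. -/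
def Arithmetical (g : Set ℕ → Set ℕ → Set ℕ) : Prop :=
  ∀ X Y, ∃ n, SetTuringReducible (g X Y) (iterJump n (setJoin X Y))

/-! ### Auxiliary facts: enumeration reducibility is a preorder -/

theorem rePred_iff_ceSet {Γ : Set ℕ} : REPred (fun n => n ∈ Γ) ↔ ∃ e, Γ = ceSet e := by
  constructor
  · intro h
    have h' := Partrec.nat_iff.1 (Partrec.map h ((Computable.const 0).to₂ : Computable₂ fun _ _ => (0 : ℕ)))
    obtain ⟨c, hc⟩ := Code.exists_code.1 h'
    refine ⟨Encodable.encode c, ?_⟩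
    ext n
    simp [ceSet, hc, Part.assert]
  · rintro ⟨e, rfl⟩
    exact (Partrec.nat_iff.2 (Code.exists_code.2 ⟨_, rfl⟩) : Partrec (Denumerable.ofNat Code e).eval).dom_re

theorem rePred_exists {α β : Type*} [Primcodable α] [Denumerable β] {R : α → β → Prop}
    (hR : PrimrecRel R) : REPred fun a => ∃ b, R a b := by
  classical
  have h : Partrec fun a => Nat.rfind fun n => (Part.some (decide (R a (Denumerable.ofNat β n))) : Part Bool) :=
    Partrec.rfind (Computable.partrec
      ((hR.comp Primrec.fst ((Primrec.ofNat β).comp Primrec.snd)).decide.to_comp))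
  refine h.dom_re.of_eq fun a => ?_
  refine Nat.rfind_dom.trans ?_
  constructor
  · rintro ⟨n, hn, -⟩
    exact ⟨_, by simpa using hn⟩
  · rintro ⟨b, hb⟩
    exact ⟨Encodable.encode b, by simpa using hb, by simp⟩

theorem ceSet_normal (e : ℕ) : ∃ R : ℕ → ℕ → Prop, PrimrecRel R ∧ ∀ n, n ∈ ceSet e ↔ ∃ s, R n s := by
  refine ⟨fun n s => ((Denumerable.ofNat Code e).evaln s n).isSome, ?_, fun n => ?_⟩
  · refine Primrec.primrecPred (Primrec.of_eq (Primrec.option_isSome.comp (Code.primrec_evaln.comp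
      ((Primrec.snd.pair (Primrec.const (Denumerable.ofNat Code e))).pair Primrec.fst))) ?_)
    intro a; simp
  · simp only [ceSet, Set.mem_ofPred_eq, Part.dom_iff_mem, Code.evaln_complete, Option.isSome_iff_exists]
    exact ⟨fun ⟨y, k, h⟩ => ⟨k, y, h⟩, fun ⟨k, y, h⟩ => ⟨y, k, h⟩⟩

/-- `p` is a positive existential condition on `B`. -/
def PosIn {α : Type*} [Primcodable α] (B : Set ℕ) (p : α → Prop) : Prop :=
  ∃ R : α → ℕ × List ℕ → Prop, PrimrecRel R ∧ ∀ a, p a ↔ ∃ w, R a w ∧ ∀ x ∈ w.2, x ∈ B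

section
variable {α β : Type*} [Primcodable α] [Primcodable β] {B : Set ℕ}

theorem PosIn.of_primrec {p : α → Prop} (h : PrimrecPred p) : PosIn B p :=
  ⟨fun a _ => p a, h.comp Primrec.fst, fun a => ⟨fun ha => ⟨(0, []), ha, by simp⟩, fun ⟨_, ha, _⟩ => ha⟩⟩

theorem PosIn.oracle : PosIn B (fun n => n ∈ B) :=
  ⟨fun a w => w.2 = [a], Primrec.eq.comp (Primrec.snd.comp Primrec.snd)
    (Primrec.list_cons.comp Primrec.fst (Primrec.const [])),
    fun a => ⟨fun ha => ⟨(0, [a]), rfl, by simpa⟩, fun ⟨w, h, h'⟩ => h' a (by simp [h])⟩⟩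

theorem PosIn.comp {p : β → Prop} {f : α → β} (h : PosIn B p) (hf : Primrec f) :
    PosIn B fun a => p (f a) := by
  obtain ⟨R, hR, h⟩ := h
  exact ⟨fun a w => R (f a) w, hR.comp (hf.comp Primrec.fst) Primrec.snd, fun a => h _⟩

theorem PosIn.and {p q : α → Prop} (hp : PosIn B p) (hq : PosIn B q) :
    PosIn B fun a => p a ∧ q a := by
  obtain ⟨R, hR, hp⟩ := hp
  obtain ⟨S, hS, hq⟩ := hq
  refine ⟨fun a w => R a ((Denumerable.ofNat ((ℕ × List ℕ) × (ℕ × List ℕ)) w.1).1) ∧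
    S a ((Denumerable.ofNat ((ℕ × List ℕ) × (ℕ × List ℕ)) w.1).2) ∧
    w.2 = (Denumerable.ofNat ((ℕ × List ℕ) × (ℕ × List ℕ)) w.1).1.2 ++
      (Denumerable.ofNat ((ℕ × List ℕ) × (ℕ × List ℕ)) w.1).2.2, ?_, fun a => ?_⟩
  · have h0 : Primrec fun w : α × (ℕ × List ℕ) =>
      Denumerable.ofNat ((ℕ × List ℕ) × (ℕ × List ℕ)) w.2.1 :=
      (Primrec.ofNat _).comp (Primrec.fst.comp Primrec.snd)
    exact (hR.comp Primrec.fst (Primrec.fst.comp h0)).and ((hS.comp Primrec.fst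
      (Primrec.snd.comp h0)).and (Primrec.eq.comp (Primrec.snd.comp Primrec.snd)
      (Primrec.list_append.comp (Primrec.snd.comp (Primrec.fst.comp h0))
        (Primrec.snd.comp (Primrec.snd.comp h0)))))
  · refine (and_congr (hp a) (hq a)).trans ?_
    constructor
    · rintro ⟨⟨w, hw, hw'⟩, ⟨v, hv, hv'⟩⟩
      refine ⟨(Encodable.encode (w, v), w.2 ++ v.2), by
        show R a _ ∧ S a _ ∧ _
        rw [Denumerable.ofNat_encode]; exact ⟨hw, hv, rfl⟩, ?_⟩
      intro x hx
      rcases List.mem_append.1 hx with h | h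
      exacts [hw' x h, hv' x h]
    · rintro ⟨w, ⟨h1, h2, h3⟩, h⟩
      rw [h3] at h
      exact ⟨⟨_, h1, fun x hx => h x (List.mem_append_left _ hx)⟩,
        ⟨_, h2, fun x hx => h x (List.mem_append_right _ hx)⟩⟩

theorem PosIn.exists {γ : Type*} [Denumerable γ] {p : α → γ → Prop}
    (hp : PosIn B fun a : α × γ => p a.1 a.2) : PosIn B fun a => ∃ b, p a b := by
  obtain ⟨R, hR, hp⟩ := hp
  refine ⟨fun a w => R (a, (Denumerable.ofNat (γ × ℕ) w.1).1)
    ((Denumerable.ofNat (γ × ℕ) w.1).2, w.2), ?_, fun a => ?_⟩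
  · have h0 : Primrec fun w : α × (ℕ × List ℕ) => Denumerable.ofNat (γ × ℕ) w.2.1 :=
      (Primrec.ofNat _).comp (Primrec.fst.comp Primrec.snd)
    exact hR.comp (Primrec.fst.pair (Primrec.fst.comp h0))
      ((Primrec.snd.comp h0).pair (Primrec.snd.comp Primrec.snd))
  · constructor
    · rintro ⟨b, hb⟩
      obtain ⟨w, hw, hw'⟩ := (hp (a, b)).1 hb
      exact ⟨(Encodable.encode (b, w.1), w.2), by
        show R _ _
        rw [Denumerable.ofNat_encode]; exact hw, hw'⟩
    · rintro ⟨w, hw, hw'⟩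
      exact ⟨_, (hp (a, _)).2 ⟨_, hw, hw'⟩⟩

theorem PosIn.forall_list {γ : Type*} [Denumerable γ] {p : α → γ → Prop}
    (hp : PosIn B fun a : α × γ => p a.1 a.2) :
    PosIn B fun a : α × List γ => ∀ b ∈ a.2, p a.1 b := by
  obtain ⟨R, hR, hp⟩ := hp
  refine ⟨fun a w => ∀ b ∈ a.2, ∃ q ∈ Denumerable.ofNat (List (γ × (ℕ × List ℕ))) w.1,
    q.1 = b ∧ R (a.1, b) q.2 ∧ ∀ y ∈ q.2.2, y ∈ w.2, ?_, fun a => ?_⟩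
  · have h1 : PrimrecRel fun (y : ℕ) (L : List ℕ) => y ∈ L := by
      refine ((PrimrecRel.exists_mem_list (R := fun a b : ℕ => a = b) Primrec.eq).swap).of_eq ?_
      intro a b; simp [Function.swap]
    have h2 : PrimrecRel fun (L M : List ℕ) => ∀ y ∈ L, y ∈ M :=
      PrimrecRel.forall_mem_list h1
    have h3 : PrimrecRel fun (q : γ × (ℕ × List ℕ)) (c : γ × ((α × List γ) × (ℕ × List ℕ))) =>
        q.1 = c.1 ∧ R (c.2.1.1, c.1) q.2 ∧ ∀ y ∈ q.2.2, y ∈ c.2.2.2 := by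
      refine (Primrec.eq.comp (Primrec.fst.comp Primrec.fst) (Primrec.fst.comp Primrec.snd)).and
        (PrimrecPred.and (hR.comp (Primrec.pair ?_ (Primrec.fst.comp Primrec.snd))
          (Primrec.snd.comp Primrec.fst)) (h2.comp (Primrec.snd.comp (Primrec.snd.comp Primrec.fst))
          (Primrec.snd.comp (Primrec.snd.comp (Primrec.snd.comp Primrec.snd)))))
      exact Primrec.fst.comp (Primrec.fst.comp (Primrec.snd.comp Primrec.snd))
    have h4 := PrimrecRel.exists_mem_list h3
    have h5 : PrimrecRel fun (b : γ) (c : (α × List γ) × (ℕ × List ℕ)) =>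
        ∃ q ∈ Denumerable.ofNat (List (γ × (ℕ × List ℕ))) c.2.1,
          q.1 = b ∧ R (c.1.1, b) q.2 ∧ ∀ y ∈ q.2.2, y ∈ c.2.2 :=
      h4.comp ((Primrec.ofNat (List (γ × (ℕ × List ℕ)))).comp
        (Primrec.fst.comp (Primrec.snd.comp Primrec.snd))) (Primrec.fst.pair Primrec.snd)
    exact (PrimrecRel.forall_mem_list h5).comp (Primrec.snd.comp Primrec.fst) Primrec.id
  · constructor
    · intro h
      choose! w hw hw' using fun b (hb : b ∈ a.2) => (hp (a.1, b)).1 (h b hb)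
      refine ⟨(Encodable.encode (a.2.map fun b => (b, w b)), a.2.flatMap fun b => (w b).2), ?_, ?_⟩
      · intro b hb
        rw [Denumerable.ofNat_encode]
        exact ⟨(b, w b), List.mem_map.2 ⟨b, hb, rfl⟩, rfl, hw b hb,
          fun y hy => List.mem_flatMap.2 ⟨b, hb, hy⟩⟩
      · intro x hx
        obtain ⟨b, hb, hx⟩ := List.mem_flatMap.1 hx
        exact hw' b hb x hx
    · rintro ⟨w, hw, hw'⟩ b hb
      obtain ⟨q, -, rfl, hq, hq'⟩ := hw b hb
      exact (hp _).2 ⟨q.2, hq, fun x hx => hw' x (hq' x hx)⟩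

end

theorem PosIn.enumReducible {A B : Set ℕ} (h : PosIn B (fun n => n ∈ A)) : EnumReducible A B := by
  obtain ⟨R, hR, h⟩ := h
  refine ⟨{p | ∃ s : ℕ, R p.unpair.1 (s, Denumerable.ofNat (List ℕ) p.unpair.2)},
    rePred_exists ?_, ?_⟩
  · exact hR.comp (Primrec.fst.comp (Primrec.unpair.comp Primrec.fst))
      (Primrec.snd.pair ((Primrec.ofNat _).comp (Primrec.snd.comp (Primrec.unpair.comp Primrec.fst))))
  · ext n
    refine (h n).trans ?_
    constructor
    · rintro ⟨⟨s, L⟩, h1, h2⟩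
      exact ⟨Encodable.encode L, ⟨s, by simpa using h1⟩, by intro k hk; exact h2 k (by simpa [finSet] using hk)⟩
    · rintro ⟨u, ⟨s, hs⟩, h2⟩
      exact ⟨_, by simpa using hs, fun x hx => h2 hx⟩

theorem EnumReducible.posIn {A B : Set ℕ} (h : EnumReducible A B) : PosIn B (fun n => n ∈ A) := by
  obtain ⟨Γ, hΓ, rfl⟩ := h
  obtain ⟨e, rfl⟩ := rePred_iff_ceSet.1 hΓ
  obtain ⟨R, hR, hRe⟩ := ceSet_normal e
  refine ⟨fun n w => R (Nat.pair n (Encodable.encode w.2)) w.1, hR.comp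
    (Primrec₂.natPair.comp Primrec.fst (Primrec.encode.comp (Primrec.snd.comp Primrec.snd)))
    (Primrec.fst.comp Primrec.snd), fun n => ?_⟩
  constructor
  · rintro ⟨u, h1, h2⟩
    obtain ⟨s, hs⟩ := (hRe _).1 h1
    exact ⟨(s, Denumerable.ofNat (List ℕ) u), by simpa using hs, fun x hx => h2 hx⟩
  · rintro ⟨⟨s, L⟩, h1, h2⟩
    exact ⟨Encodable.encode L, (hRe _).2 ⟨s, h1⟩, by
      intro k hk; exact h2 k (by simpa [finSet] using hk)⟩

theorem EnumReducible.refl (A : Set ℕ) : EnumReducible A A := PosIn.oracle.enumReducible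

theorem EnumReducible.trans {A B C : Set ℕ} (h₁ : EnumReducible A B) (h₂ : EnumReducible B C) :
    EnumReducible A C := by
  obtain ⟨R, hR, h⟩ := h₁.posIn
  have h3 : PosIn C fun a : Unit × List ℕ => ∀ b ∈ a.2, b ∈ B :=
    PosIn.forall_list (p := fun (_ : Unit) b => b ∈ B) (h₂.posIn.comp Primrec.snd)
  have h4 : PosIn C fun a : ℕ × (ℕ × List ℕ) => R a.1 a.2 ∧ ∀ x ∈ a.2.2, x ∈ B :=
    (PosIn.of_primrec hR).and (h3.comp (f := fun a : ℕ × (ℕ × List ℕ) => ((), a.2.2))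
      ((Primrec.const ()).pair (Primrec.snd.comp Primrec.snd)))
  have h5 := PosIn.exists (p := fun n (w : ℕ × List ℕ) => R n w ∧ ∀ x ∈ w.2, x ∈ B) h4
  apply PosIn.enumReducible
  obtain ⟨T, hT, h6⟩ := h5
  exact ⟨T, hT, fun n => (h n).trans (h6 n)⟩

/-! ### Auxiliary facts: the sets `ceSetIn A e` are the sets c.e. in `A` in the sense of oracle
computations -/

theorem mem_setJoin_even (A B : Set ℕ) (n : ℕ) : 2 * n ∈ setJoin A B ↔ n ∈ A := by
  simp [setJoin]

theorem mem_setJoin_odd (A B : Set ℕ) (n : ℕ) : 2 * n + 1 ∈ setJoin A B ↔ n ∈ B := by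
  have : (2 * n + 1) / 2 = n := by omega
  have : (2 * n + 1) % 2 = 1 := by omega
  simp [setJoin, *]

theorem PosIn.congr {α : Type*} [Primcodable α] {B : Set ℕ} {p q : α → Prop} (h : PosIn B p)
    (H : ∀ a, q a ↔ p a) : PosIn B q := by
  obtain ⟨R, hR, h⟩ := h
  exact ⟨R, hR, fun a => (H a).trans (h a)⟩

theorem mem_prec_iff {f h : ℕ →. ℕ} (a n m : ℕ) :
    m ∈ (n.rec (f a) fun y IH => do
          let i ← IH
          h (Nat.pair a (Nat.pair y i)) : Part ℕ) ↔
    ∃ l : List ℕ, (l.getD 0 0 ∈ f a ∧ ∀ i ∈ List.range n,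
      l.getD (i + 1) 0 ∈ h (Nat.pair a (Nat.pair i (l.getD i 0)))) ∧ m = l.getD n 0 := by
  constructor
  · suffices H : m ∈ (n.rec (f a) fun y IH => do
          let i ← IH
          h (Nat.pair a (Nat.pair y i)) : Part ℕ) → ∃ l : List ℕ, l.length = n + 1 ∧
          (l.getD 0 0 ∈ f a ∧ ∀ i ∈ List.range n,
      l.getD (i + 1) 0 ∈ h (Nat.pair a (Nat.pair i (l.getD i 0)))) ∧ m = l.getD n 0 from
      fun hm => (H hm).imp fun _ => And.right
    induction n generalizing m with
    | zero => intro hm; exact ⟨[m], rfl, ⟨hm, by simp⟩, rfl⟩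
    | succ n ih =>
      intro hm
      obtain ⟨i, hi, hm⟩ := Part.mem_bind_iff.1 hm
      obtain ⟨l, hl, ⟨h0, h1⟩, h2⟩ := ih i hi
      have key : ∀ j, j ≤ n → (l ++ [m]).getD j 0 = l.getD j 0 := fun j hj => by
        rw [List.getD_append]; omega
      have last : (l ++ [m]).getD (n + 1) 0 = m := by
        rw [List.getD_append_right _ _ _ _ (by omega), hl]; simp
      refine ⟨l ++ [m], by simp [hl], ⟨by rw [key 0 (by omega)]; exact h0, ?_⟩, last.symm⟩
      intro j hj
      rw [List.mem_range] at hj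
      rcases Nat.lt_succ_iff_lt_or_eq.1 hj with hj' | rfl
      · rw [key j (by omega), key (j + 1) (by omega)]
        exact h1 j (List.mem_range.2 hj')
      · rw [last, key j le_rfl, ← h2]; exact hm
  · rintro ⟨l, ⟨h0, h1⟩, rfl⟩
    induction n with
    | zero => exact h0
    | succ n ih =>
      refine Part.mem_bind_iff.2 ⟨_, ih fun i hi => h1 i ?_, h1 n (by simp)⟩
      simp at hi ⊢; omega

theorem posIn_graph (A : Set ℕ) {f : ℕ →. ℕ} (hf : Nat.RecursiveIn {charFun A} f) :
    PosIn (setJoin A Aᶜ) fun p : ℕ × ℕ => p.2 ∈ f p.1 := by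
  induction hf with
  | zero =>
    exact (PosIn.of_primrec (p := fun p : ℕ × ℕ => p.2 = 0)
      (Primrec.eq.comp Primrec.snd (Primrec.const _))).congr 
        fun a => Part.mem_some_iff
  | succ =>
    exact (PosIn.of_primrec (p := fun p : ℕ × ℕ => p.2 = p.1.succ)
      (Primrec.eq.comp Primrec.snd (Primrec.succ.comp Primrec.fst))).congr fun a => by simp
  | left =>
    exact (PosIn.of_primrec (p := fun p : ℕ × ℕ => p.2 = p.1.unpair.1)
      (Primrec.eq.comp Primrec.snd (Primrec.fst.comp (Primrec.unpair.comp Primrec.fst)))).congr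
        fun a => by simp
  | right =>
    exact (PosIn.of_primrec (p := fun p : ℕ × ℕ => p.2 = p.1.unpair.2)
      (Primrec.eq.comp Primrec.snd (Primrec.snd.comp (Primrec.unpair.comp Primrec.fst)))).congr
        fun a => by simp
  | oracle g hg =>
    rw [Set.mem_singleton_iff.1 hg]
    refine ((PosIn.of_primrec (p := fun p : ℕ × ℕ => p.2 ≤ 1)
      (Primrec.nat_le.comp Primrec.snd (Primrec.const 1))).and
      (PosIn.oracle.comp (f := fun p : ℕ × ℕ => 2 * p.1 + (1 - p.2))
        (Primrec.nat_add.comp (Primrec.nat_mul.comp (Primrec.const 2) Primrec.fst)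
          (Primrec.nat_sub.comp (Primrec.const 1) Primrec.snd)))).congr ?_
    rintro ⟨n, m⟩
    rcases m with _ | _ | m
    · simp [charFun, mem_setJoin_odd]
    · simp [charFun, mem_setJoin_even]
    · simp only [charFun, Part.mem_some_iff]; split_ifs <;> simp
  | pair _ _ ih1 ih2 =>
    refine ((ih1.comp (f := fun p : ℕ × ℕ => (p.1, p.2.unpair.1)) (Primrec.fst.pair
      (Primrec.fst.comp (Primrec.unpair.comp Primrec.snd)))).and
      (ih2.comp (f := fun p : ℕ × ℕ => (p.1, p.2.unpair.2)) (Primrec.fst.pair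
      (Primrec.snd.comp (Primrec.unpair.comp Primrec.snd))))).congr ?_
    rintro ⟨n, m⟩
    simp only [Seq.seq, Part.mem_bind_iff, Part.map_eq_map, Part.mem_map_iff]
    constructor
    · rintro ⟨_, ⟨a, ha, rfl⟩, b, hb, rfl⟩
      simpa using ⟨ha, hb⟩
    · rintro ⟨h1, h2⟩
      exact ⟨_, ⟨_, h1, rfl⟩, _, h2, by simp⟩
  | @comp f h _ _ ih1 ih2 =>
    refine (PosIn.exists (p := fun (p : ℕ × ℕ) (y : ℕ) => y ∈ h p.1 ∧ p.2 ∈ f y)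
      ((ih2.comp (f := fun q : (ℕ × ℕ) × ℕ => (q.1.1, q.2))
        ((Primrec.fst.comp Primrec.fst).pair Primrec.snd)).and
      (ih1.comp (f := fun q : (ℕ × ℕ) × ℕ => (q.2, q.1.2))
        (Primrec.snd.pair (Primrec.snd.comp Primrec.fst))))).congr ?_
    rintro ⟨n, m⟩
    exact Part.mem_bind_iff
  | @prec f h _ _ ih1 ih2 =>
    have e1 : PosIn (setJoin A Aᶜ) fun q : (ℕ × ℕ) × List ℕ => q.2.getD 0 0 ∈ f q.1.1.unpair.1 :=
      ih1.comp (f := fun q : (ℕ × ℕ) × List ℕ => (q.1.1.unpair.1, q.2.getD 0 0))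
        ((Primrec.fst.comp (Primrec.unpair.comp (Primrec.fst.comp Primrec.fst))).pair
          ((Primrec.list_getD 0).comp Primrec.snd (Primrec.const 0)))
    have e2 : PosIn (setJoin A Aᶜ) fun q : ((ℕ × ℕ) × List ℕ) × ℕ =>
        q.1.2.getD (q.2 + 1) 0 ∈ h (Nat.pair q.1.1.1.unpair.1 (Nat.pair q.2 (q.1.2.getD q.2 0))) :=
      ih2.comp (f := fun q : ((ℕ × ℕ) × List ℕ) × ℕ =>
        (Nat.pair q.1.1.1.unpair.1 (Nat.pair q.2 (q.1.2.getD q.2 0)), q.1.2.getD (q.2 + 1) 0))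
        (((Primrec₂.natPair.comp (Primrec.fst.comp (Primrec.unpair.comp (Primrec.fst.comp
          (Primrec.fst.comp Primrec.fst)))) (Primrec₂.natPair.comp Primrec.snd
            ((Primrec.list_getD 0).comp (Primrec.snd.comp Primrec.fst) Primrec.snd)))).pair
          ((Primrec.list_getD 0).comp (Primrec.snd.comp Primrec.fst)
            (Primrec.succ.comp Primrec.snd)))
    have e3 := (PosIn.forall_list (p := fun (q : (ℕ × ℕ) × List ℕ) (i : ℕ) =>
      q.2.getD (i + 1) 0 ∈ h (Nat.pair q.1.1.unpair.1 (Nat.pair i (q.2.getD i 0)))) e2).comp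
      (f := fun q : (ℕ × ℕ) × List ℕ => (q, List.range q.1.1.unpair.2))
      (Primrec.id.pair (Primrec.list_range.comp (Primrec.snd.comp (Primrec.unpair.comp
        (Primrec.fst.comp Primrec.fst)))))
    have e4 : PosIn (setJoin A Aᶜ) fun q : (ℕ × ℕ) × List ℕ => q.1.2 = q.2.getD q.1.1.unpair.2 0 :=
      PosIn.of_primrec (Primrec.eq.comp (Primrec.snd.comp Primrec.fst)
        ((Primrec.list_getD 0).comp Primrec.snd (Primrec.snd.comp (Primrec.unpair.comp
          (Primrec.fst.comp Primrec.fst)))))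
    refine (PosIn.exists (p := fun (p : ℕ × ℕ) (l : List ℕ) => (l.getD 0 0 ∈ f p.1.unpair.1 ∧
      ∀ i ∈ List.range p.1.unpair.2,
      l.getD (i + 1) 0 ∈ h (Nat.pair p.1.unpair.1 (Nat.pair i (l.getD i 0)))) ∧
        p.2 = l.getD p.1.unpair.2 0) ((e1.and e3).and e4)).congr ?_
    rintro ⟨p, m⟩
    exact mem_prec_iff _ _ _
  | @rfind f _ ih =>
    have e1 : PosIn (setJoin A Aᶜ) fun q : (ℕ × ℕ) × ℕ => ∃ y, y ≠ 0 ∧ y ∈ f (Nat.pair q.1.1 q.2) := by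
      refine PosIn.exists (p := fun (q : (ℕ × ℕ) × ℕ) (y : ℕ) => y ≠ 0 ∧ y ∈ f (Nat.pair q.1.1 q.2))
        ((PosIn.of_primrec ((Primrec.eq.comp Primrec.snd (Primrec.const 0)).not)).and
        (ih.comp (f := fun q : ((ℕ × ℕ) × ℕ) × ℕ => (Nat.pair q.1.1.1 q.1.2, q.2))
          ((Primrec₂.natPair.comp (Primrec.fst.comp (Primrec.fst.comp Primrec.fst))
            (Primrec.snd.comp Primrec.fst)).pair Primrec.snd)))
    refine ((ih.comp (f := fun p : ℕ × ℕ => (Nat.pair p.1 p.2, 0))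
      ((Primrec₂.natPair.comp Primrec.fst Primrec.snd).pair (Primrec.const 0))).and
      ((PosIn.forall_list (p := fun (q : ℕ × ℕ) (i : ℕ) => ∃ y, y ≠ 0 ∧ y ∈ f (Nat.pair q.1 i))
        e1).comp (f := fun p : ℕ × ℕ => (p, List.range p.2))
        (Primrec.id.pair (Primrec.list_range.comp Primrec.snd)))).congr ?_
    rintro ⟨n, m⟩
    refine Nat.mem_rfind.trans (and_congr ?_ ?_)
    · simp
    · simp only [List.mem_range]
      refine forall₂_congr fun i _ => ?_
      simp [and_comm]

/-- Total functions recursive in `A`. -/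
def RecTot (A : Set ℕ) (F : ℕ → ℕ) : Prop :=
  Nat.RecursiveIn {charFun A} fun n => Part.some (F n)

theorem RecTot.of_primrec {A : Set ℕ} {F : ℕ → ℕ} (h : Primrec F) : RecTot A F :=
  (Primrec.nat_iff.1 h).recursiveIn

theorem RecTot.comp {A : Set ℕ} {F G : ℕ → ℕ} (hF : RecTot A F) (hG : RecTot A G) :
    RecTot A fun n => F (G n) :=
  (Nat.RecursiveIn.comp hF hG).of_eq fun n => by simp

theorem RecTot.pair {A : Set ℕ} {F G : ℕ → ℕ} (hF : RecTot A F) (hG : RecTot A G) :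
    RecTot A fun n => Nat.pair (F n) (G n) :=
  (Nat.RecursiveIn.pair hF hG).of_eq fun n => by simp [Seq.seq]

theorem RecTot.comp₂ {A : Set ℕ} {P : ℕ → ℕ → ℕ} {F G : ℕ → ℕ} (hP : Primrec₂ P)
    (hF : RecTot A F) (hG : RecTot A G) : RecTot A fun n => P (F n) (G n) :=
  ((RecTot.of_primrec (F := fun n => P n.unpair.1 n.unpair.2)
    (hP.comp (Primrec.fst.comp Primrec.unpair) (Primrec.snd.comp Primrec.unpair))).comp
      (hF.pair hG)).of_eq fun n => by simp

theorem RecTot.prec {A : Set ℕ} {F H : ℕ → ℕ} (hF : RecTot A F) (hH : RecTot A H) :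
    RecTot A fun p => p.unpair.2.rec (F p.unpair.1)
      fun y IH => H (Nat.pair p.unpair.1 (Nat.pair y IH)) := by
  refine (Nat.RecursiveIn.prec hF hH).of_eq fun p => ?_
  simp only
  generalize p.unpair.2 = n
  induction n with
  | zero => rfl
  | succ n ih => simp only [ih]; simp

open Classical in
theorem recTot_join (A : Set ℕ) : RecTot A fun n => if n ∈ setJoin A Aᶜ then 0 else 1 := by
  have h0 : RecTot A fun n => if n ∈ A then 1 else 0 := Nat.RecursiveIn.oracle _ rfl
  have h1 := RecTot.comp₂ (P := fun a b => if a % 2 = 0 then 1 - b else b)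
    (Primrec.ite (Primrec.eq.comp (Primrec.nat_mod.comp Primrec.fst (Primrec.const 2))
      (Primrec.const 0)) (Primrec.nat_sub.comp (Primrec.const 1) Primrec.snd) Primrec.snd)
    (RecTot.of_primrec Primrec.id)
    (h0.comp (RecTot.of_primrec (Primrec.nat_div.comp Primrec.id (Primrec.const 2))))
  refine Nat.RecursiveIn.of_eq h1 fun n => ?_
  rcases Nat.mod_two_eq_zero_or_one n with h | h <;> by_cases h' : n / 2 ∈ A <;> simp [setJoin, h, h']

open Classical in
theorem recTot_all (A : Set ℕ) : RecTot A fun p =>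
    if ∀ x ∈ (Denumerable.ofNat (List ℕ) p.unpair.1).take p.unpair.2, x ∈ setJoin A Aᶜ
      then 0 else 1 := by
  have e1 : Primrec fun q : ℕ => (Denumerable.ofNat (List ℕ) q.unpair.1)[q.unpair.2.unpair.1]? :=
    Primrec.list_getElem?.comp ((Primrec.ofNat _).comp (Primrec.fst.comp Primrec.unpair))
      (Primrec.fst.comp (Primrec.unpair.comp (Primrec.snd.comp Primrec.unpair)))
  have e2 := RecTot.comp₂ (A := A)
    (P := fun a b => if (Denumerable.ofNat (List ℕ) a.unpair.1)[a.unpair.2.unpair.1]? = Option.none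
      then a.unpair.2.unpair.2 else a.unpair.2.unpair.2 + b - a.unpair.2.unpair.2 * b)
    (by
      have e3 : Primrec fun q : ℕ × ℕ => q.1.unpair.2.unpair.2 :=
        Primrec.snd.comp (Primrec.unpair.comp (Primrec.snd.comp (Primrec.unpair.comp Primrec.fst)))
      exact Primrec.ite (Primrec.eq.comp (e1.comp Primrec.fst) (Primrec.const Option.none)) e3
        (Primrec.nat_sub.comp (Primrec.nat_add.comp e3 Primrec.snd)
          (Primrec.nat_mul.comp e3 Primrec.snd)))
    (RecTot.of_primrec Primrec.id)
    ((recTot_join A).comp (RecTot.of_primrec (Primrec.option_getD.comp e1 (Primrec.const 0))))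
  refine Nat.RecursiveIn.of_eq (RecTot.prec (RecTot.of_primrec (Primrec.const 0)) e2) fun p => ?_
  refine congrArg Part.some ?_
  simp only [id]
  generalize p.unpair.2 = n
  induction n with
  | zero => simp
  | succ n ih =>
    simp only [ih]
    simp only [Nat.unpair_pair]
    generalize Denumerable.ofNat (List ℕ) p.unpair.1 = l
    rw [List.take_add_one]
    rcases h : l[n]? with _ | x
    · simp
    · by_cases h1 : x ∈ setJoin A Aᶜ <;>
        by_cases h2 : ∀ y ∈ l.take n, y ∈ setJoin A Aᶜ <;> simp [h1, h2, or_imp, forall_and]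

theorem PosIn.dom {A S : Set ℕ} (h : PosIn (setJoin A Aᶜ) fun n => n ∈ S) :
    ∃ f : ℕ →. ℕ, Nat.RecursiveIn {charFun A} f ∧ S = f.Dom := by
  classical
  obtain ⟨R, hR, h⟩ := h
  have e1 : Primrec fun q : ℕ => Denumerable.ofNat (ℕ × ℕ) q.unpair.2 :=
    (Primrec.ofNat _).comp (Primrec.snd.comp Primrec.unpair)
  have e0 : Primrec fun q : ℕ => Denumerable.ofNat (List ℕ) (Denumerable.ofNat (ℕ × ℕ) q.unpair.2).2 :=
    (Primrec.ofNat _).comp (Primrec.snd.comp e1)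
  have e2 : RecTot A fun q => if R q.unpair.1 ((Denumerable.ofNat (ℕ × ℕ) q.unpair.2).1,
      Denumerable.ofNat (List ℕ) (Denumerable.ofNat (ℕ × ℕ) q.unpair.2).2) then 0 else 1 :=
    RecTot.of_primrec (Primrec.ite (hR.comp (Primrec.fst.comp Primrec.unpair)
      ((Primrec.fst.comp e1).pair e0)) (Primrec.const 0) (Primrec.const 1))
  have e3 := (recTot_all A).comp ((RecTot.of_primrec (Primrec.snd.comp e1)).pair
    (RecTot.of_primrec (Primrec.list_length.comp e0)))
  have e4 := RecTot.comp₂ Primrec.nat_add e2 e3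
  refine ⟨_, Nat.RecursiveIn.rfind e4, ?_⟩
  ext n
  refine (h n).trans (Iff.trans ?_ Nat.rfind_dom.symm)
  constructor
  · rintro ⟨⟨t, l⟩, h1, h2⟩
    refine ⟨Encodable.encode (t, Encodable.encode l), ?_, fun _ => trivial⟩
    refine (Part.mem_map_iff _).2 ⟨_, Part.mem_some _, ?_⟩
    simpa [h1] using h2
  · rintro ⟨w, h1, -⟩
    obtain ⟨m, hm, h2⟩ := (Part.mem_map_iff _).1 h1
    rw [Part.mem_some_iff] at hm
    subst hm
    simp at h2
    exact ⟨_, h2⟩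

theorem exists_dom_iff_ceSetIn (A S : Set ℕ) :
    (∃ f : ℕ →. ℕ, RecursiveIn {charFun A} f ∧ S = f.Dom) ↔ ∃ e, S = ceSetIn A e := by
  constructor
  · rintro ⟨f, hf, rfl⟩
    have h1 := PosIn.exists (p := fun n m => m ∈ f n) (posIn_graph A (RecursiveIn.iff_nat.1 hf))
    obtain ⟨Γ, hΓ, h⟩ := PosIn.enumReducible (A := f.Dom) (h1.congr fun n => by
      simp [PFun.mem_dom])
    obtain ⟨e, rfl⟩ := rePred_iff_ceSet.1 hΓ
    exact ⟨e, h⟩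
  · rintro ⟨e, h⟩
    obtain ⟨f, hf, h'⟩ := PosIn.dom (EnumReducible.posIn ⟨_, rePred_iff_ceSet.2 ⟨e, rfl⟩, h⟩)
    exact ⟨f, RecursiveIn.iff_nat.2 hf, h'⟩

/-! ### Enumeration degrees -/

/-- Enumeration equivalence as a setoid. -/
def enumSetoid : Setoid (Set ℕ) where
  r := EnumEquiv
  iseqv := ⟨fun A => ⟨.refl A, .refl A⟩, fun h => ⟨h.2, h.1⟩,
    fun h k => ⟨h.1.trans k.1, k.2.trans h.2⟩⟩

/-- The enumeration degrees `𝒟ₑ = 𝒫(ℕ) / ≡ₑ`. -/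
def EnumDegree : Type := Quotient enumSetoid

/-- The enumeration degree of a set. -/
def degE (A : Set ℕ) : EnumDegree := Quotient.mk enumSetoid A

/-- The order on degrees induced by `≤ₑ`. -/
def EnumDegree.le (a b : EnumDegree) : Prop :=
  Quotient.liftOn₂ a b EnumReducible fun _ _ _ _ h k =>
    propext ⟨fun l => (h.2.trans l).trans k.1, fun l => (h.1.trans l).trans k.2⟩

/-- The degrees are ordered by `deg A ≤ deg B ↔ A ≤ₑ B`. -/
instance : PartialOrder EnumDegree where
  le := EnumDegree.le
  le_refl := by
    rintro ⟨A⟩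
    exact EnumReducible.refl A
  le_trans := by
    rintro ⟨A⟩ ⟨B⟩ ⟨C⟩ h k
    exact EnumReducible.trans h k
  le_antisymm := by
    rintro ⟨A⟩ ⟨B⟩ h k
    exact Quotient.sound ⟨h, k⟩

theorem degE_le_degE {A B : Set ℕ} : degE A ≤ degE B ↔ EnumReducible A B := by
  exact Iff.rfl

/-- A set `A` is total if `Aᶜ ≤ₑ A`. -/
def IsTotalSet (A : Set ℕ) : Prop := EnumReducible Aᶜ A

/-- A degree is total if it contains a total set. -/
def EnumDegree.IsTotal (a : EnumDegree) : Prop := ∃ A, IsTotalSet A ∧ degE A = a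

/-- `b` is a strong quasiminimal cover of `a`. -/
def IsStrongQuasiminimalCover (b a : EnumDegree) : Prop :=
  a < b ∧ ∀ c : EnumDegree, c.IsTotal → c ≤ b → c ≤ a

/-- The finite binary string `σ` is an initial segment of (the characteristic function of) `G`. -/
def IsInitialSegment (σ : List Bool) (G : Set ℕ) : Prop :=
  ∀ i (hi : i < σ.length), σ[i] = true ↔ i ∈ G

/-- `G` is `⟨A⟩`-generic: for every set `W` of finite binary strings with `W ≤ₑ A` (strings being
identified with their codes), some initial segment of `G` is in `W` or has no extension in `W`. -/
def IsEnumGeneric (A G : Set ℕ) : Prop :=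
  ∀ W : Set (List Bool), EnumReducible (Encodable.encode '' W) A →
    ∃ σ, IsInitialSegment σ G ∧ (σ ∈ W ∨ ∀ τ, σ <+: τ → τ ∉ W)

/-- `G` is `A`-generic (1-generic relative to the total oracle `A`): `⟨A ⊕ Aᶜ⟩`-generic. -/
def IsGenericRel (A G : Set ℕ) : Prop := IsEnumGeneric (setJoin A Aᶜ) G

/-- The class `𝒞(A) = {degₑ g(A, C) | C ⊆ ℕ}`. -/
def degClass (g : Set ℕ → Set ℕ → Set ℕ) (A : Set ℕ) : Set EnumDegree :=
  {d | ∃ C : Set ℕ, d = degE (g A C)}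

end EnumDeg

open EnumDeg

/-!
Every set `X` is assigned a string at every stage of one construction, which treats all subsets of
`ℕ` simultaneously; the union `G_X` of the strings of `X` is its generic set, and
`M_A = (A ⊕ Aᶜ) ⊕ G_X` for `X = A ⊕ Aᶜ`. At each stage the string of `X` is extended into the next
set of strings enumerated from `X`, if possible; this makes `G_X` generic
(`isEnumGeneric_genericSet`), and genericity gives a strong quasiminimal cover
(`IsEnumGeneric.isStrongQuasiminimalCover`).

If `M_A ≡ₑ M_B`, then `X = A ⊕ Aᶜ` and `Y = B ⊕ Bᶜ` are enumeration equivalent, because they are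
total and the covers are quasiminimal. So only equivalent `X ≠ Y` have to be kept apart. A stage
codes `(n, e, i, j)` and handles all pairs with `Y = Γ_i(X)`, `X = Γ_j(Y)` and `n ∈ X \ Y` at once.
The operators `Γ_i`, `Γ_j` are inverse to each other on these pairs, and `n` tells the two
components apart, so the pairs form a matching: both strings of a pair can be extended, by a choice on which
`X` and `Y` agree, so that `Γ_e(X ⊕ G_X)` contains a number which `G_Y` lacks. If there are no such
extensions, `Γ_e(X ⊕ G_X)` is finite while `G_Y` is infinite
(`genericSet_not_enumReducible`).

The string of `X` at stage `s + 1` depends on those of `X` and of one set `Γ_i(X)` at stage `s`.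
Hence it is determined by a finite table of strings of sets `Γ_k(X)`. For `X = A ⊕ Aᶜ`, correctness
of a table is a `Σ⁰₃(A)` condition (`sigmaIn_correct`), so `M_A` is `Σ⁰₃(A)` and recursive in
`A^(4)`, and even in `A^(3)`. Cofinality holds because `C ≤ₑ A ⊕ C ≤ₑ M_{A ⊕ C}`.
-/

namespace EnumDeg

open Nat.Partrec (Code)

/-! ### Primitive recursive functions and the tactic `fun_prop` -/

attribute [local fun_prop] Primrec
attribute [local fun_prop] Primrec.id Primrec.const Primrec.comp
attribute [local fun_prop] Primrec.fst Primrec.snd Primrec.pair Primrec.encode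

section
variable {α β : Type*} [Primcodable α] [Primcodable β]

theorem primrec_getElem? {f : α → List β} {g : α → ℕ} (hf : Primrec f) (hg : Primrec g) :
    Primrec fun a => (f a)[g a]? :=
  Primrec.list_getElem?.comp hf hg

theorem primrec_natPair {f g : α → ℕ} (hf : Primrec f) (hg : Primrec g) :
    Primrec fun a => Nat.pair (f a) (g a) :=
  Primrec₂.natPair.comp hf hg

theorem primrec_ofNat {γ : Type*} [Denumerable γ] {f : α → ℕ} (hf : Primrec f) :
    Primrec fun a => Denumerable.ofNat γ (f a) :=
  (Primrec.ofNat γ).comp hf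

theorem primrec_add {f g : α → ℕ} (hf : Primrec f) (hg : Primrec g) :
    Primrec fun a => f a + g a :=
  Primrec.nat_add.comp hf hg

theorem primrec_mul {f g : α → ℕ} (hf : Primrec f) (hg : Primrec g) :
    Primrec fun a => f a * g a :=
  Primrec.nat_mul.comp hf hg

theorem primrec_div {f g : α → ℕ} (hf : Primrec f) (hg : Primrec g) :
    Primrec fun a => f a / g a :=
  Primrec.nat_div.comp hf hg

theorem primrec_mod {f g : α → ℕ} (hf : Primrec f) (hg : Primrec g) :
    Primrec fun a => f a % g a :=
  Primrec.nat_mod.comp hf hg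

/-- The element of `γ` with code `n`, with a default value for the numbers that code nothing. -/
def decodeD (γ : Type*) [Primcodable γ] [Inhabited γ] (n : ℕ) : γ :=
  (Encodable.decode n : Option γ).getD default

@[simp]
theorem decodeD_encode {γ : Type*} [Primcodable γ] [Inhabited γ] (c : γ) :
    decodeD γ (Encodable.encode c) = c := by
  simp [decodeD]

theorem primrec_decodeD {γ : Type*} [Primcodable γ] [Inhabited γ] {f : α → ℕ} (hf : Primrec f) :
    Primrec fun a => decodeD γ (f a) :=
  Primrec.option_getD.comp (Primrec.decode.comp hf) (Primrec.const _)

end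

attribute [local fun_prop] primrec_getElem? primrec_natPair primrec_ofNat primrec_add
attribute [local fun_prop] primrec_mul primrec_div primrec_mod primrec_decodeD

section
variable {α β : Type*} [Primcodable α] [Primcodable β]

theorem primrecPred_eq {f g : α → β} (hf : Primrec f) (hg : Primrec g) :
    PrimrecPred fun a => f a = g a :=
  Primrec.eq.comp hf hg

theorem primrecPred_mem_list {f : α → β} {g : α → List β} (hf : Primrec f) (hg : Primrec g) :
    PrimrecPred fun a => f a ∈ g a := by
  refine ((PrimrecRel.exists_mem_list (R := fun a b : β => a = b) Primrec.eq).comp hg hf).of_eq ?_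
  intro a; simp

theorem primrecPred_prefix {f g : α → List Bool} (hf : Primrec f) (hg : Primrec g) :
    PrimrecPred fun a => f a <+: g a := by
  refine (primrecPred_eq hf (Primrec.list_take.comp (Primrec.list_length.comp hf) hg)).of_eq ?_
  intro a; exact List.prefix_iff_eq_take.symm

/-! ### Closure properties of positive existential conditions -/

variable {B : Set ℕ}

theorem PosIn.or {p q : α → Prop} (hp : PosIn B p) (hq : PosIn B q) :
    PosIn B fun a => p a ∨ q a := by
  obtain ⟨R, hR, hp⟩ := hp
  obtain ⟨S, hS, hq⟩ := hq
  refine ⟨fun a w => R a w ∨ S a w, PrimrecPred.or hR hS, fun a => ?_⟩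
  refine (or_congr (hp a) (hq a)).trans ?_
  rw [← exists_or]
  exact exists_congr fun w => or_and_right.symm

theorem PosIn.exists_decode {γ : Type*} [Primcodable γ] [Inhabited γ] {p : α → γ → Prop}
    (hp : PosIn B fun a : α × γ => p a.1 a.2) : PosIn B fun a => ∃ c, p a c := by
  refine (PosIn.exists (p := fun a n => p a (decodeD γ n))
    (hp.comp (f := fun a : α × ℕ => (a.1, decodeD γ a.2)) (by fun_prop))).congr fun a => ?_
  exact ⟨fun ⟨c, hc⟩ => ⟨Encodable.encode c, by simpa using hc⟩, fun ⟨n, hn⟩ => ⟨_, hn⟩⟩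

theorem PosIn.ceSet {e f : α → ℕ} (he : Primrec e) (hf : Primrec f) :
    PosIn B fun a => f a ∈ ceSet (e a) := by
  refine ⟨fun a w => ((Denumerable.ofNat Code (e a)).evaln w.1 (f a)).isSome, ?_, fun a => ?_⟩
  · refine Primrec.primrecPred (Primrec.of_eq (Primrec.option_isSome.comp (Code.primrec_evaln.comp
      (((Primrec.fst.comp Primrec.snd).pair ((Primrec.ofNat Code).comp
        (he.comp Primrec.fst))).pair (hf.comp Primrec.fst)))) ?_)
    intro a; simp
  · simp only [EnumDeg.ceSet, Set.mem_ofPred_eq, Part.dom_iff_mem, Code.evaln_complete,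
      Option.isSome_iff_exists]
    exact ⟨fun ⟨y, k, h⟩ => ⟨(k, []), ⟨y, h⟩, by simp⟩, fun ⟨k, ⟨y, h⟩, _⟩ => ⟨y, k.1, h⟩⟩

/-- Membership in `Γ_e(S)` is a positive existential condition, uniformly in the index `e` and in
a uniformly given family of sets `S`. -/
theorem PosIn.mem_enumOp {S : α → Set ℕ} {e f : α → ℕ} (he : Primrec e) (hf : Primrec f)
    (hS : PosIn B fun q : α × ℕ => q.2 ∈ S q.1) :
    PosIn B fun a => f a ∈ enumOp (EnumDeg.ceSet (e a)) (S a) := by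
  refine (PosIn.exists (γ := ℕ) (p := fun a u => Nat.pair (f a) u ∈ EnumDeg.ceSet (e a) ∧
    ∀ y ∈ Denumerable.ofNat (List ℕ) u, y ∈ S a) (PosIn.and ?_ ?_)).congr fun a => ?_
  · exact PosIn.ceSet (by fun_prop) (by fun_prop)
  · exact (PosIn.forall_list (p := fun a y => y ∈ S a) hS).comp
      (f := fun a : α × ℕ => (a.1, Denumerable.ofNat (List ℕ) a.2)) (by fun_prop)
  · exact Iff.rfl

end

/-! ### The arithmetical hierarchy relative to a set -/

/-- The set `A ⊕ Aᶜ`, whose enumeration degree is the total degree corresponding to the Turing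
degree of `A`. -/
def selfJoin (A : Set ℕ) : Set ℕ := setJoin A Aᶜ

/-- The predicate `p` is `Σ⁰ₙ₊₁` relative to `A`, that is, c.e. in the `n`-th jump of `A`. -/
def SigmaIn {α : Type*} [Primcodable α] (A : Set ℕ) (n : ℕ) (p : α → Prop) : Prop :=
  PosIn (selfJoin (iterJump n A)) p

/-- The predicate `p` is `Δ⁰ₙ₊₁` relative to `A`. -/
def DeltaIn {α : Type*} [Primcodable α] (A : Set ℕ) (n : ℕ) (p : α → Prop) : Prop :=
  SigmaIn A n p ∧ SigmaIn A n fun a => ¬ p a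

section
variable {α β : Type*} [Primcodable α] [Primcodable β] {A : Set ℕ} {n : ℕ} {p q : α → Prop}

/-- A `Σ⁰₁(Z)` predicate is many-one reducible to the jump of `Z`. -/
theorem exists_index_jump [Inhabited α] {Z : Set ℕ} (hp : PosIn (selfJoin Z) p) :
    ∃ e, ∀ a, p a ↔ Nat.pair e (Encodable.encode a) ∈ jump Z := by
  have h : PosIn (selfJoin Z) fun n => n ∈ {n | ∃ a : α, Encodable.encode a = n ∧ p a} :=
    PosIn.exists_decode (p := fun n a => Encodable.encode a = n ∧ p a)
      ((PosIn.of_primrec (primrecPred_eq (by fun_prop) (by fun_prop))).and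
        (hp.comp (by fun_prop)))
  obtain ⟨Γ, hΓ, hE⟩ := h.enumReducible
  obtain ⟨e, rfl⟩ := rePred_iff_ceSet.1 hΓ
  refine ⟨e, fun a => ?_⟩
  have : Encodable.encode a ∈ {n | ∃ a : α, Encodable.encode a = n ∧ p a} ↔ p a := by simp
  rw [← this, hE]
  simp [jump, ceSetIn, selfJoin]

theorem SigmaIn.delta [Inhabited α] (hp : SigmaIn A n p) : DeltaIn A (n + 1) p := by
  obtain ⟨e, he⟩ := exists_index_jump hp
  have hj : iterJump (n + 1) A = jump (iterJump n A) := Function.iterate_succ_apply' _ _ _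
  unfold DeltaIn SigmaIn
  rw [hj]
  constructor
  · refine (PosIn.oracle.comp (f := fun a => 2 * Nat.pair e (Encodable.encode a))
      (by fun_prop)).congr fun a => ?_
    rw [he, selfJoin, mem_setJoin_even]
  · refine (PosIn.oracle.comp (f := fun a => 2 * Nat.pair e (Encodable.encode a) + 1)
      (by fun_prop)).congr fun a => ?_
    rw [he, selfJoin, mem_setJoin_odd]; rfl

theorem DeltaIn.of_primrec (h : PrimrecPred p) : DeltaIn A n p :=
  ⟨PosIn.of_primrec h, PosIn.of_primrec h.not⟩

theorem DeltaIn.congr (h : DeltaIn A n p) (H : ∀ a, q a ↔ p a) : DeltaIn A n q :=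
  ⟨PosIn.congr h.1 H, PosIn.congr h.2 fun a => not_congr (H a)⟩

theorem DeltaIn.comp {p : β → Prop} {f : α → β} (h : DeltaIn A n p) (hf : Primrec f) :
    DeltaIn A n fun a => p (f a) :=
  ⟨PosIn.comp h.1 hf, PosIn.comp (p := fun b => ¬ p b) h.2 hf⟩

theorem DeltaIn.not (h : DeltaIn A n p) : DeltaIn A n fun a => ¬ p a :=
  ⟨h.2, PosIn.congr h.1 fun _ => not_not⟩

theorem DeltaIn.and (hp : DeltaIn A n p) (hq : DeltaIn A n q) : DeltaIn A n fun a => p a ∧ q a :=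
  ⟨PosIn.and hp.1 hq.1, (PosIn.or hp.2 hq.2).congr fun _ => not_and_or⟩

theorem DeltaIn.or (hp : DeltaIn A n p) (hq : DeltaIn A n q) : DeltaIn A n fun a => p a ∨ q a :=
  (hp.not.and hq.not).not.congr fun a => by tauto

theorem DeltaIn.iff (hp : DeltaIn A n p) (hq : DeltaIn A n q) :
    DeltaIn A n fun a => (p a ↔ q a) :=
  ((hp.and hq).or (hp.not.and hq.not)).congr fun a => by tauto

theorem DeltaIn.succ [Inhabited α] (hp : DeltaIn A n p) : DeltaIn A (n + 1) p := SigmaIn.delta hp.1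

theorem DeltaIn.exists [Inhabited α] {γ : Type*} [Primcodable γ] [Inhabited γ] {p : α → γ → Prop}
    (hp : DeltaIn A n fun a : α × γ => p a.1 a.2) : DeltaIn A (n + 1) fun a => ∃ c, p a c :=
  SigmaIn.delta (PosIn.exists_decode hp.1)

theorem DeltaIn.forall [Inhabited α] {γ : Type*} [Primcodable γ] [Inhabited γ] {p : α → γ → Prop}
    (hp : DeltaIn A n fun a : α × γ => p a.1 a.2) : DeltaIn A (n + 1) fun a => ∀ c, p a c :=
  (DeltaIn.exists (p := fun a c => ¬ p a c) hp.not).not.congr fun a => by simp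

end

/-- A total function whose graph is c.e. in `A` is recursive in `A`. -/
theorem recTot_of_posIn_graph {A : Set ℕ} {F : ℕ → ℕ}
    (h : PosIn (setJoin A Aᶜ) fun q : ℕ × ℕ => q.2 = F q.1) : RecTot A F := by
  classical
  obtain ⟨R, hR, h⟩ := h
  -- The search is over triples `(m, t, l)` of a value, a witness and a list of oracle queries.
  let v : ℕ → ℕ × ℕ × List ℕ := Denumerable.ofNat (ℕ × ℕ × List ℕ)
  have hv : Primrec fun q : ℕ => v q.unpair.2 :=
    (Primrec.ofNat _).comp (Primrec.snd.comp Primrec.unpair)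
  have e2 : RecTot A fun q => if R (q.unpair.1, (v q.unpair.2).1) (v q.unpair.2).2 then 0 else 1 :=
    RecTot.of_primrec (Primrec.ite (hR.comp ((Primrec.fst.comp Primrec.unpair).pair
      (Primrec.fst.comp hv)) (Primrec.snd.comp hv)) (Primrec.const 0) (Primrec.const 1))
  have e3 := (recTot_all A).comp ((RecTot.of_primrec (Primrec.encode.comp
      (Primrec.snd.comp (Primrec.snd.comp hv)))).pair
    (RecTot.of_primrec (Primrec.list_length.comp (Primrec.snd.comp (Primrec.snd.comp hv)))))
  let g : ℕ → ℕ := fun q => if R (q.unpair.1, (v q.unpair.2).1) (v q.unpair.2).2 ∧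
      ∀ x ∈ (v q.unpair.2).2.2, x ∈ setJoin A Aᶜ then 0 else 1
  have e4 : RecTot A g := by
    refine Nat.RecursiveIn.of_eq (RecTot.comp₂ (P := fun a b => if a = 0 then b else 1)
      (Primrec.ite (Primrec.eq.comp Primrec.fst (Primrec.const 0)) Primrec.snd (Primrec.const 1))
      e2 e3) fun q => ?_
    by_cases h1 : R (q.unpair.1, (v q.unpair.2).1) (v q.unpair.2).2 <;> simp [g, h1]
  have e5 : RecTot A fun w => (v w).1 :=
    RecTot.of_primrec (Primrec.fst.comp (Primrec.ofNat _))
  refine Nat.RecursiveIn.of_eq (Nat.RecursiveIn.comp e5 (Nat.RecursiveIn.rfind e4)) fun n => ?_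
  refine Part.eq_some_iff.2 ?_
  have hg : ∀ w, g (Nat.pair n w) = 0 ↔
      R (n, (v w).1) (v w).2 ∧ ∀ x ∈ (v w).2.2, x ∈ setJoin A Aᶜ := fun w => by simp [g]
  obtain ⟨u, hu⟩ : ∃ u, u ∈ Nat.rfind fun w =>
      (fun m => decide (m = 0)) <$> Part.some (g (Nat.pair n w)) := by
    obtain ⟨w, hw, hw'⟩ := (h (n, F n)).1 rfl
    refine Part.dom_iff_mem.1 (Nat.rfind_dom.2 ⟨Encodable.encode (F n, w), ?_, fun _ => trivial⟩)
    have : g (Nat.pair n (Encodable.encode (F n, w))) = 0 := by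
      rw [hg]
      simp only [v, Denumerable.ofNat_encode]
      exact ⟨hw, hw'⟩
    exact (Part.mem_map_iff _).2 ⟨_, Part.mem_some _, by rw [this]; rfl⟩
  have hu0 : g (Nat.pair n u) = 0 := by simpa using Nat.rfind_spec hu
  refine Part.mem_bind_iff.2 ⟨u, hu, ?_⟩
  rw [Part.mem_some_iff]
  obtain ⟨h1, h2⟩ := (hg u).1 hu0
  exact ((h (n, (v u).1)).2 ⟨_, h1, h2⟩).symm

/-- Post's theorem: a set that is `Δ⁰ₙ₊₁` relative to `A` is recursive in the `n`-th jump. -/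
theorem DeltaIn.setTuringReducible {A S : Set ℕ} {n : ℕ} (h : DeltaIn A n fun x => x ∈ S) :
    SetTuringReducible S (iterJump n A) := by
  classical
  refine RecursiveIn.iff_nat.2 (recTot_of_posIn_graph (F := fun x => if x ∈ S then 1 else 0) ?_)
  have h1 := ((PosIn.of_primrec (primrecPred_eq Primrec.snd (Primrec.const 1))).and
    (PosIn.comp h.1 Primrec.fst)).or
    ((PosIn.of_primrec (primrecPred_eq Primrec.snd (Primrec.const 0))).and
    (PosIn.comp h.2 (Primrec.fst (β := ℕ))))
  refine h1.congr fun q => ?_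
  by_cases hq : q.1 ∈ S <;> simp [hq]

/-! ### Finite strings and enumeration operators -/

/-- The set of positions at which the string `σ` has a `1`. -/
def posPart (σ : List Bool) : Set ℕ := {i | σ[i]? = some true}

open Classical in
/-- The initial segment of length `N` of (the characteristic function of) `G`. -/
noncomputable def restr (G : Set ℕ) (N : ℕ) : List Bool :=
  (List.range N).map fun i => decide (i ∈ G)

@[simp]
theorem length_restr (G : Set ℕ) (N : ℕ) : (restr G N).length = N := by simp [restr]

theorem mem_posPart_restr {G : Set ℕ} {N i : ℕ} : i ∈ posPart (restr G N) ↔ i < N ∧ i ∈ G := by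
  by_cases h : i < N <;> simp [posPart, restr, h]

theorem IsInitialSegment.posPart_subset {σ : List Bool} {G : Set ℕ} (h : IsInitialSegment σ G) :
    posPart σ ⊆ G := by
  intro i hi
  obtain ⟨hl, hi⟩ := List.getElem?_eq_some_iff.1 hi
  exact (h i hl).1 hi

theorem IsInitialSegment.prefix_restr {σ : List Bool} {G : Set ℕ} (h : IsInitialSegment σ G)
    {N : ℕ} (hN : σ.length ≤ N) : σ <+: restr G N := by
  rw [List.prefix_iff_eq_take]
  refine List.ext_getElem (by simpa using hN) fun i hi _ => ?_
  have := h i hi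
  simp only [restr, List.getElem_take, List.getElem_map, List.getElem_range]
  by_cases hG : i ∈ G <;> simp_all

theorem posPart_mono {σ τ : List Bool} (h : σ <+: τ) : posPart σ ⊆ posPart τ := by
  obtain ⟨ρ, rfl⟩ := h
  intro i hi
  obtain ⟨hl, -⟩ := List.getElem?_eq_some_iff.1 hi
  simpa [posPart, List.getElem?_append_left hl] using hi

theorem exists_extension {β : List Bool} {x : ℕ} (h : β.length ≤ x) (b : Bool) :
    ∃ β', β <+: β' ∧ β'[x]? = some b := by
  refine ⟨β ++ List.replicate (x + 1 - β.length) b, List.prefix_append _ _, ?_⟩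
  rw [List.getElem?_append_right h, List.getElem?_replicate, if_pos (by omega)]

theorem enumOp_mono {Γ B C : Set ℕ} (h : B ⊆ C) : enumOp Γ B ⊆ enumOp Γ C :=
  fun _ ⟨u, hu, hB⟩ => ⟨u, hu, hB.trans h⟩

theorem setJoin_mono {B B' C C' : Set ℕ} (h : B ⊆ B') (h' : C ⊆ C') :
    setJoin B C ⊆ setJoin B' C' :=
  fun _ hn => hn.imp (fun k => ⟨k.1, h k.2⟩) fun k => ⟨k.1, h' k.2⟩

/-- An enumeration operator uses only a finite initial segment of its oracle. -/
theorem exists_restr_of_mem_enumOp {Γ X G : Set ℕ} {x : ℕ} (h : x ∈ enumOp Γ (setJoin X G)) :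
    ∃ N, ∀ M, N ≤ M → x ∈ enumOp Γ (setJoin X (posPart (restr G M))) := by
  obtain ⟨u, hu, hB⟩ := h
  refine ⟨(Denumerable.ofNat (List ℕ) u).sum + 1, fun M hM => ⟨u, hu, fun y hy => ?_⟩⟩
  have hle : y ≤ (Denumerable.ofNat (List ℕ) u).sum := List.le_sum_of_mem hy
  exact (hB hy).imp_right fun k => ⟨k.1, mem_posPart_restr.2 ⟨by omega, k.2⟩⟩

section
variable {α : Type*} [Primcodable α] {B : Set ℕ}

theorem PosIn.mem_setJoin {S T : α → Set ℕ} {f : α → ℕ} (hf : Primrec f)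
    (hS : PosIn B fun q : α × ℕ => q.2 ∈ S q.1) (hT : PosIn B fun q : α × ℕ => q.2 ∈ T q.1) :
    PosIn B fun a => f a ∈ setJoin (S a) (T a) := by
  have h (r : ℕ) : PosIn B fun a => f a % 2 = r :=
    PosIn.of_primrec (primrecPred_eq (by fun_prop) (by fun_prop))
  exact ((h 0).and (hS.comp (f := fun a => (a, f a / 2)) (by fun_prop))).or
    ((h 1).and (hT.comp (f := fun a => (a, f a / 2)) (by fun_prop)))

theorem PosIn.mem_posPart {f : α → ℕ} {σ : α → List Bool} (hf : Primrec f) (hσ : Primrec σ) :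
    PosIn B fun a => f a ∈ posPart (σ a) :=
  PosIn.of_primrec (primrecPred_eq (by fun_prop) (by fun_prop))

/-- Uniform enumerability of `Γ_e(S ⊕ σ)`, for a finite string `σ` in place of a set. -/
theorem PosIn.mem_enumOp_posPart {S : α → Set ℕ} {e f : α → ℕ} {σ : α → List Bool}
    (he : Primrec e) (hf : Primrec f) (hσ : Primrec σ)
    (hS : PosIn B fun q : α × ℕ => q.2 ∈ S q.1) :
    PosIn B fun a => f a ∈ enumOp (EnumDeg.ceSet (e a)) (setJoin (S a) (posPart (σ a))) := by
  refine PosIn.mem_enumOp he hf ?_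
  refine PosIn.mem_setJoin (S := fun q : α × ℕ => S q.1) (T := fun q : α × ℕ => posPart (σ q.1))
    (by fun_prop) ?_ ?_
  · exact hS.comp (f := fun q : (α × ℕ) × ℕ => (q.1.1, q.2)) (by fun_prop)
  · exact PosIn.mem_posPart (by fun_prop) (by fun_prop)

end

theorem EnumReducible.exists_index {A B : Set ℕ} (h : EnumReducible A B) :
    ∃ e, A = enumOp (ceSet e) B := by
  obtain ⟨Γ, hΓ, h⟩ := h
  obtain ⟨e, rfl⟩ := rePred_iff_ceSet.1 hΓ
  exact ⟨e, h⟩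

/-! ### Generic sets give strong quasiminimal covers -/

section
variable {X G : Set ℕ}

theorem IsEnumGeneric.exists_of_posIn (h : IsEnumGeneric X G) {W : Set (List Bool)}
    (hW : PosIn X fun σ => σ ∈ W) :
    ∃ σ, IsInitialSegment σ G ∧ (σ ∈ W ∨ ∀ τ, σ <+: τ → τ ∉ W) := by
  refine h W (PosIn.enumReducible ?_)
  refine (PosIn.exists_decode (p := fun n σ => σ ∈ W ∧ Encodable.encode σ = n)
    ((hW.comp (by fun_prop)).and (PosIn.of_primrec (primrecPred_eq (by fun_prop)
      (by fun_prop))))).congr fun n => ?_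
  exact Iff.rfl

theorem IsEnumGeneric.exists_mem_ge (h : IsEnumGeneric X G) (n : ℕ) : ∃ i ∈ G, n ≤ i := by
  obtain ⟨σ, hσ, ⟨i, hi, hn⟩ | hσW⟩ := h.exists_of_posIn
    (W := {σ | ∃ i, i ∈ posPart σ ∧ n ≤ i}) (PosIn.exists
      (p := fun (σ : List Bool) i => i ∈ posPart σ ∧ n ≤ i)
      ((PosIn.mem_posPart (by fun_prop) (by fun_prop)).and
        (PosIn.of_primrec (Primrec.nat_le.comp (Primrec.const _) Primrec.snd))))
  · exact ⟨i, hσ.posPart_subset hi, hn⟩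
  · obtain ⟨τ, hτ, hx⟩ := exists_extension (le_max_left σ.length n) true
    exact absurd ⟨_, hx, le_max_right _ _⟩ (hσW τ hτ)

theorem IsEnumGeneric.not_enumReducible (h : IsEnumGeneric X G) : ¬ EnumReducible G X := by
  intro hG
  obtain ⟨σ, hσ, ⟨i, hi, hiG⟩ | hσW⟩ := h.exists_of_posIn
    (W := {σ | ∃ i, σ[i]? = some false ∧ i ∈ G}) (PosIn.exists
      (p := fun (σ : List Bool) i => σ[i]? = some false ∧ i ∈ G)
      ((PosIn.of_primrec (primrecPred_eq (by fun_prop) (by fun_prop))).and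
        (hG.posIn.comp (by fun_prop))))
  · obtain ⟨hl, hi⟩ := List.getElem?_eq_some_iff.1 hi
    have := (hσ i hl).2 hiG
    simp_all
  · obtain ⟨i, hiG, hi⟩ := h.exists_mem_ge σ.length
    obtain ⟨τ, hτ, hx⟩ := exists_extension hi false
    exact hσW τ hτ ⟨i, hx, hiG⟩

/-- A total set below `X ⊕ G` is below `X`: no initial segment of `G` can force the two given
operators to enumerate a common element, hence above some initial segment `σ` of `G` every
element enumerated by an extension of `σ` is correct. -/
theorem IsEnumGeneric.enumReducible_of_total (h : IsEnumGeneric X G) {C : Set ℕ}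
    (hC : EnumReducible C (setJoin X G)) (hC' : EnumReducible Cᶜ (setJoin X G)) :
    EnumReducible C X := by
  obtain ⟨e, he⟩ := hC.exists_index
  obtain ⟨l, hl⟩ := hC'.exists_index
  have hop (e : ℕ) : PosIn X fun q : List Bool × ℕ =>
      q.2 ∈ enumOp (ceSet e) (setJoin X (posPart q.1)) :=
    PosIn.mem_enumOp_posPart (S := fun _ => X) (by fun_prop) (by fun_prop) (by fun_prop)
      (PosIn.oracle.comp (by fun_prop))
  obtain ⟨σ, hσ, ⟨x, hxe, hxl⟩ | hσW⟩ := h.exists_of_posIn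
    (W := {σ | ∃ x, x ∈ enumOp (ceSet e) (setJoin X (posPart σ)) ∧
      x ∈ enumOp (ceSet l) (setJoin X (posPart σ))}) (PosIn.exists ((hop e).and (hop l)))
  · have hsub := setJoin_mono (subset_refl X) hσ.posPart_subset
    have h1 : x ∈ C := he ▸ enumOp_mono hsub hxe
    have h2 : x ∈ Cᶜ := hl ▸ enumOp_mono hsub hxl
    exact absurd h1 h2
  · have hpos : PosIn X fun x => ∃ τ : List Bool, σ <+: τ ∧
        x ∈ enumOp (ceSet e) (setJoin X (posPart τ)) :=
      PosIn.exists_decode ((PosIn.of_primrec (primrecPred_prefix (by fun_prop) (by fun_prop))).and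
        ((hop e).comp (f := fun q : ℕ × List Bool => (q.2, q.1)) (by fun_prop)))
    refine (hpos.congr fun x => ⟨fun hx => ?_, ?_⟩).enumReducible
    · rw [he] at hx
      obtain ⟨N, hN⟩ := exists_restr_of_mem_enumOp hx
      exact ⟨restr G (max N σ.length), hσ.prefix_restr (le_max_right _ _), hN _ (le_max_left _ _)⟩
    · rintro ⟨τ, hτ, hx⟩
      by_contra hxC
      have hxl : x ∈ enumOp (ceSet l) (setJoin X G) := hl ▸ hxC
      -- `σ` is still an initial segment of the set obtained from `G` by adding the ones of `τ`.
      have hσH : IsInitialSegment σ (posPart τ ∪ G) := by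
        intro i hi
        have h1 : i ∈ posPart τ ↔ σ[i] = true := by
          obtain ⟨ρ, rfl⟩ := hτ
          simp [posPart, List.getElem?_append_left hi, hi]
        rw [Set.mem_union, h1, ← hσ i hi, or_self]
      obtain ⟨N, hN⟩ := exists_restr_of_mem_enumOp
        (enumOp_mono (setJoin_mono (subset_refl X) (Set.subset_union_left (t := G))) hx)
      obtain ⟨N', hN'⟩ := exists_restr_of_mem_enumOp
        (enumOp_mono (setJoin_mono (subset_refl X) (Set.subset_union_right (s := posPart τ))) hxl)
      refine hσW (restr (posPart τ ∪ G) (max (max N N') σ.length))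
        (hσH.prefix_restr (le_max_right _ _)) ⟨x, hN _ ?_, hN' _ ?_⟩ <;> omega

end

theorem enumReducible_setJoin_left (A B : Set ℕ) : EnumReducible A (setJoin A B) :=
  ((PosIn.oracle (B := setJoin A B)).comp (f := fun n => 2 * n) (by fun_prop)).congr
    (fun n => (mem_setJoin_even A B n).symm) |>.enumReducible

theorem enumReducible_setJoin_right (A B : Set ℕ) : EnumReducible B (setJoin A B) :=
  ((PosIn.oracle (B := setJoin A B)).comp (f := fun n => 2 * n + 1) (by fun_prop)).congr
    (fun n => (mem_setJoin_odd A B n).symm) |>.enumReducible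

theorem isTotalSet_selfJoin (A : Set ℕ) : IsTotalSet (selfJoin A) := by
  refine PosIn.enumReducible ((PosIn.mem_setJoin (S := fun _ => Aᶜ) (T := fun _ => A)
    Primrec.id ?_ ?_).congr fun n => ?_)
  · exact (enumReducible_setJoin_right A Aᶜ).posIn.comp (by fun_prop)
  · exact (enumReducible_setJoin_left A Aᶜ).posIn.comp (by fun_prop)
  · rcases Nat.mod_two_eq_zero_or_one n with h | h <;> simp [selfJoin, setJoin, h]

theorem selfJoin_injective : Function.Injective selfJoin := by
  intro A B h
  ext n
  rw [← mem_setJoin_even A Aᶜ, ← mem_setJoin_even B Bᶜ]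
  exact Set.ext_iff.1 h (2 * n)

theorem IsEnumGeneric.isStrongQuasiminimalCover {X G : Set ℕ} (h : IsEnumGeneric X G) :
    IsStrongQuasiminimalCover (degE (setJoin X G)) (degE X) := by
  refine ⟨lt_iff_le_not_ge.2 ⟨enumReducible_setJoin_left X G, fun hle =>
    h.not_enumReducible ((enumReducible_setJoin_right X G).trans hle)⟩, ?_⟩
  rintro _ ⟨C, hC, rfl⟩ hle
  exact h.enumReducible_of_total hle (EnumReducible.trans hC hle)

/-! ### The simultaneous construction -/

/-- The value of the `k`-th enumeration operator on `X`. -/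
abbrev ceOp (k : ℕ) (X : Set ℕ) : Set ℕ := enumOp (ceSet k) X

open Classical in
/-- The element with the least code that satisfies `Q`, or `d` if nothing satisfies `Q`. -/
noncomputable def leastCode {γ : Type*} [Encodable γ] (Q : γ → Prop) (d : γ) : γ :=
  if h : ∃ c, Q c ∧ ∀ c', Q c' → Encodable.encode c ≤ Encodable.encode c' then h.choose else d

section
variable {γ : Type*} [Encodable γ] {Q : γ → Prop} {d y : γ}

theorem exists_least_encode (h : ∃ c, Q c) :
    ∃ c, Q c ∧ ∀ c', Q c' → Encodable.encode c ≤ Encodable.encode c' := by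
  obtain ⟨m, ⟨c, hc, rfl⟩, hmin⟩ := WellFounded.has_min (wellFounded_lt (α := ℕ))
    {m | ∃ c, Q c ∧ Encodable.encode c = m} (h.elim fun c hc => ⟨_, c, hc, rfl⟩)
  exact ⟨c, hc, fun c' hc' => not_lt.1 (hmin _ ⟨c', hc', rfl⟩)⟩

theorem leastCode_eq_default (h : ∀ c, ¬ Q c) : leastCode Q d = d :=
  dif_neg fun ⟨c, hc, _⟩ => h c hc

theorem leastCode_spec (h : ∃ c, Q c) : Q (leastCode Q d) ∧
    ∀ c', Q c' → Encodable.encode (leastCode Q d) ≤ Encodable.encode c' := by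
  rw [leastCode, dif_pos (exists_least_encode h)]
  exact (exists_least_encode h).choose_spec

theorem leastCode_eq_iff : leastCode Q d = y ↔
    (Q y ∧ ∀ c, Q c → Encodable.encode y ≤ Encodable.encode c) ∨ ((∀ c, ¬ Q c) ∧ d = y) := by
  by_cases h : ∃ c, Q c
  · have hs := leastCode_spec (d := d) h
    constructor
    · rintro rfl
      exact Or.inl hs
    · rintro (⟨h1, h2⟩ | ⟨h1, -⟩)
      · exact Encodable.encode_injective (le_antisymm (hs.2 _ h1) (h2 _ hs.1))
      · exact absurd h (not_exists.2 h1)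
  · rw [leastCode_eq_default (not_exists.1 h)]
    exact ⟨fun hd => Or.inr ⟨not_exists.1 h, hd⟩, fun hd => hd.elim (fun k => absurd ⟨_, k.1⟩ h)
      And.right⟩

end

/-- `τ` extends `α` and meets the `e`-th set of strings enumerated from `X`. -/
def Meets (e : ℕ) (X : Set ℕ) (α τ : List Bool) : Prop :=
  α <+: τ ∧ Encodable.encode τ ∈ ceOp e X

/-- The least extension of `α` in the `e`-th set of strings enumerated from `X`, if there is one. -/
noncomputable def genericExt (e : ℕ) (X : Set ℕ) (α : List Bool) : List Bool :=
  leastCode (Meets e X α) α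

/-- The strings `p.1 ⊇ α` and `p.2 ⊇ β` force `Γ_e(X ⊕ G) ≠ H` for all `G ⊇ p.1` and `H ⊇ p.2`: the
operator enumerates a number at which `p.2` is `0`. -/
def Separates (e : ℕ) (X : Set ℕ) (α β : List Bool) (p : List Bool × List Bool) : Prop :=
  (α <+: p.1 ∧ β <+: p.2) ∧
    ∃ x, x ∈ ceOp e (setJoin X (posPart p.1)) ∧ p.2[x]? = some false

/-- The least separating pair of extensions of `α` and `β`, if there is one. -/
noncomputable def separation (e : ℕ) (X : Set ℕ) (α β : List Bool) : List Bool × List Bool :=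
  leastCode (Separates e X α β) (α, β)

/-- The task `r = (n, e, i, j)` concerns all pairs `X`, `Y` with `Y = Γ_i(X)`, `X = Γ_j(Y)` and
`n ∈ X \ Y`. Here `X` is the first component of such a pair. -/
def IsFst (r : ℕ × ℕ × ℕ × ℕ) (X : Set ℕ) : Prop :=
  (r.1 ∈ X ∧ r.1 ∉ ceOp r.2.2.1 X) ∧ X = ceOp r.2.2.2 (ceOp r.2.2.1 X)

/-- `Y` is the second component of a pair `X`, `Y` which the task `r` concerns. -/
def IsSnd (r : ℕ × ℕ × ℕ × ℕ) (Y : Set ℕ) : Prop :=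
  (r.1 ∉ Y ∧ r.1 ∈ ceOp r.2.2.2 Y) ∧ Y = ceOp r.2.2.1 (ceOp r.2.2.2 Y)

open Classical in
/-- Given the current strings `f` of all sets, the string of `X` after the task `r`. As a set occurs
in at most one of the pairs which the task concerns, both components of each pair make the same
choice of a separation. -/
noncomputable def pairStep (r : ℕ × ℕ × ℕ × ℕ) (f : Set ℕ → List Bool) (X : Set ℕ) : List Bool :=
  if IsFst r X then (separation r.2.1 X (f X) (f (ceOp r.2.2.1 X))).1
  else if IsSnd r X then (separation r.2.1 (ceOp r.2.2.2 X) (f (ceOp r.2.2.2 X)) (f X)).2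
  else f X

/-- The initial segment of the generic set of `X` that is fixed after `s` stages, for all sets `X`
simultaneously. -/
noncomputable def stage : ℕ → Set ℕ → List Bool
  | 0, _ => []
  | s + 1, X => genericExt s X (pairStep (Denumerable.ofNat _ s) (stage s) X)

/-- The generic set that the construction assigns to `X`. -/
noncomputable def genericSet (X : Set ℕ) : Set ℕ := {i | ∃ s, i ∈ posPart (stage s X)}

theorem prefix_genericExt (e : ℕ) (X : Set ℕ) (α : List Bool) : α <+: genericExt e X α := by
  by_cases h : ∃ τ, Meets e X α τ
  · exact (leastCode_spec h).1.1
  · rw [genericExt, leastCode_eq_default (not_exists.1 h)]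

theorem prefix_separation (e : ℕ) (X : Set ℕ) (α β : List Bool) :
    α <+: (separation e X α β).1 ∧ β <+: (separation e X α β).2 := by
  by_cases h : ∃ p, Separates e X α β p
  · exact (leastCode_spec h).1.1
  · rw [separation, leastCode_eq_default (not_exists.1 h)]
    exact ⟨List.prefix_rfl, List.prefix_rfl⟩

theorem prefix_pairStep (r : ℕ × ℕ × ℕ × ℕ) (f : Set ℕ → List Bool) (X : Set ℕ) :
    f X <+: pairStep r f X := by
  unfold pairStep
  split_ifs
  · exact (prefix_separation _ _ _ _).1
  · exact (prefix_separation _ _ _ _).2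
  · exact List.prefix_rfl

theorem pairStep_prefix_stage (s : ℕ) (X : Set ℕ) :
    pairStep (Denumerable.ofNat _ s) (stage s) X <+: stage (s + 1) X :=
  prefix_genericExt _ _ _

theorem stage_prefix {s t : ℕ} (h : s ≤ t) (X : Set ℕ) : stage s X <+: stage t X := by
  induction t, h using Nat.le_induction with
  | base => exact List.prefix_rfl
  | succ t _ ih => exact ih.trans ((prefix_pairStep _ _ _).trans (pairStep_prefix_stage t X))

theorem isInitialSegment_stage (s : ℕ) (X : Set ℕ) :
    IsInitialSegment (stage s X) (genericSet X) := by
  intro i hi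
  refine ⟨fun h => ⟨s, by simp [posPart, hi, h]⟩, fun ⟨t, ht⟩ => ?_⟩
  have h1 := posPart_mono (stage_prefix (le_max_right s t) X) ht
  obtain ⟨ρ, hρ⟩ := stage_prefix (le_max_left s t) X
  simpa [posPart, ← hρ, List.getElem?_append_left hi, hi] using h1

theorem isEnumGeneric_genericSet (X : Set ℕ) : IsEnumGeneric X (genericSet X) := by
  intro W hW
  obtain ⟨e, he⟩ := hW.exists_index
  have hmem (τ : List Bool) : Encodable.encode τ ∈ ceOp e X ↔ τ ∈ W := by
    rw [ceOp, ← he, Encodable.encode_injective.mem_set_image]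
  refine ⟨stage (e + 1) X, isInitialSegment_stage _ _, ?_⟩
  rw [stage]
  set α := pairStep (Denumerable.ofNat _ e) (stage e) X
  by_cases h : ∃ τ, Meets e X α τ
  · exact Or.inl ((hmem _).1 (leastCode_spec h).1.2)
  · refine Or.inr fun τ hτ hτW => h ⟨τ, ?_, (hmem τ).2 hτW⟩
    exact (prefix_genericExt e X α).trans hτ

theorem IsFst.isSnd {r : ℕ × ℕ × ℕ × ℕ} {X : Set ℕ} (h : IsFst r X) :
    IsSnd r (ceOp r.2.2.1 X) := by
  unfold IsSnd
  rw [← h.2]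
  exact ⟨⟨h.1.2, h.1.1⟩, rfl⟩

/-- If `X ≡ₑ Y` and `X` is not contained in `Y`, then the stage with the task `(n, e, i, j)` ensures
that `Γ_e(X ⊕ G_X) ≠ G_Y`. -/
theorem genericSet_not_enumReducible {X Y : Set ℕ} (hXY : EnumEquiv X Y) {n : ℕ} (hX : n ∈ X)
    (hY : n ∉ Y) : ¬ EnumReducible (genericSet Y) (setJoin X (genericSet X)) := by
  intro hred
  obtain ⟨j, hj⟩ := hXY.1.exists_index
  obtain ⟨i, hi⟩ := hXY.2.exists_index
  obtain ⟨e, he⟩ := hred.exists_index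
  set r : ℕ × ℕ × ℕ × ℕ := (n, e, i, j) with hr
  set s := Encodable.encode r with hs
  have hfst : IsFst r X := ⟨⟨hX, fun h => hY (hi ▸ h)⟩, by simp only [hr, ceOp, ← hi, ← hj]⟩
  have hsnd : IsSnd r Y := by
    have := hfst.isSnd
    rwa [show ceOp r.2.2.1 X = Y from hi.symm] at this
  have hnot : ¬ IsFst r Y := fun h => hY h.1.1
  have h1 := pairStep_prefix_stage s X
  have h2 := pairStep_prefix_stage s Y
  rw [hs, Denumerable.ofNat_encode, ← hs, pairStep, if_pos hfst,
    show ceOp r.2.2.1 X = Y from hi.symm] at h1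
  rw [hs, Denumerable.ofNat_encode, ← hs, pairStep, if_neg hnot, if_pos hsnd,
    show ceOp r.2.2.2 Y = X from hj.symm] at h2
  change (separation e X _ _).1 <+: _ at h1
  change (separation e X _ _).2 <+: _ at h2
  by_cases h : ∃ p, Separates e X (stage s X) (stage s Y) p
  · have hsep : Separates e X (stage s X) (stage s Y) (separation e X (stage s X) (stage s Y)) :=
      (leastCode_spec h).1
    obtain ⟨-, x, hx, hxY⟩ := hsep
    have hxG : x ∈ genericSet Y := by
      rw [he]
      exact enumOp_mono (setJoin_mono (subset_refl X) ((posPart_mono h1).trans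
        (isInitialSegment_stage _ X).posPart_subset)) hx
    have hxG' : (stage (s + 1) Y)[x]? = some false := by
      obtain ⟨ρ, hρ⟩ := h2
      obtain ⟨hl, -⟩ := List.getElem?_eq_some_iff.1 hxY
      rw [← hρ, List.getElem?_append_left hl]
      exact hxY
    obtain ⟨hl, hf⟩ := List.getElem?_eq_some_iff.1 hxG'
    have := (isInitialSegment_stage (s + 1) Y x hl).2 hxG
    exact Bool.false_ne_true (hf.symm.trans this)
  · -- Without a separation, the operator enumerates no number beyond the length of `stage s Y`.
    obtain ⟨x, hx, hxs⟩ := (isEnumGeneric_genericSet Y).exists_mem_ge (stage s Y).length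
    obtain ⟨τ, hτ, hxτ⟩ := exists_extension hxs false
    rw [he] at hx
    obtain ⟨N, hN⟩ := exists_restr_of_mem_enumOp hx
    exact h ⟨(restr (genericSet X) (max N (stage s X).length), τ),
      ⟨(isInitialSegment_stage s X).prefix_restr (le_max_right _ _), hτ⟩,
      x, hN _ (le_max_left _ _), hxτ⟩

/-! ### The arithmetical complexity of the construction -/

section
variable {α : Type*} [Primcodable α] {A : Set ℕ} {k l e f : α → ℕ}

theorem posIn_mem_ceOp (hk : Primrec k) (hf : Primrec f) :
    PosIn (selfJoin A) fun a => f a ∈ ceOp (k a) (selfJoin A) :=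
  PosIn.mem_enumOp (S := fun _ => selfJoin A) hk hf (PosIn.oracle.comp Primrec.snd)

theorem posIn_mem_ceOp_ceOp (hk : Primrec k) (hl : Primrec l) (hf : Primrec f) :
    PosIn (selfJoin A) fun a => f a ∈ ceOp (l a) (ceOp (k a) (selfJoin A)) :=
  PosIn.mem_enumOp (S := fun a => ceOp (k a) (selfJoin A)) hl hf
    (posIn_mem_ceOp (by fun_prop) (by fun_prop))

theorem posIn_mem_ceOp_ceOp_ceOp (hk : Primrec k) (hl : Primrec l) (he : Primrec e)
    (hf : Primrec f) :
    PosIn (selfJoin A) fun a => f a ∈ ceOp (e a) (ceOp (l a) (ceOp (k a) (selfJoin A))) :=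
  PosIn.mem_enumOp (S := fun a => ceOp (l a) (ceOp (k a) (selfJoin A))) he hf
    (posIn_mem_ceOp_ceOp (by fun_prop) (by fun_prop) (by fun_prop))

end

section
variable {α : Type*} [Primcodable α] [Inhabited α] {A : Set ℕ}

theorem DeltaIn.set_eq {n : ℕ} {S T : α → Set ℕ} (hS : DeltaIn A n fun q : α × ℕ => q.2 ∈ S q.1)
    (hT : DeltaIn A n fun q : α × ℕ => q.2 ∈ T q.1) : DeltaIn A (n + 1) fun a => S a = T a :=
  (DeltaIn.forall (p := fun a x => x ∈ S a ↔ x ∈ T a) (hS.iff hT)).congr fun _ => Set.ext_iff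

theorem DeltaIn.leastCode_eq {n : ℕ} {γ : Type*} [Primcodable γ] [Inhabited γ] {Q : α → γ → Prop}
    {d y : α → γ} (hQ : DeltaIn A n fun q : α × γ => Q q.1 q.2) (hd : Primrec d)
    (hy : Primrec y) : DeltaIn A (n + 1) fun a => leastCode (Q a) (d a) = y a := by
  have h1 : DeltaIn A (n + 1) fun a => Q a (y a) :=
    (hQ.comp (f := fun a => (a, y a)) (by fun_prop)).succ
  have h2 : DeltaIn A (n + 1) fun a => ∀ c, ¬ Q a c := DeltaIn.forall hQ.not
  have h3 : DeltaIn A (n + 1) fun a => ∀ c, ¬ Q a c ∨ Encodable.encode (y a) ≤ Encodable.encode c :=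
    DeltaIn.forall (hQ.not.or (DeltaIn.of_primrec (Primrec.nat_le.comp
      (Primrec.encode.comp (hy.comp Primrec.fst)) (Primrec.encode.comp Primrec.snd))))
  refine ((h1.and h3).or (h2.and (DeltaIn.of_primrec (primrecPred_eq hd hy)))).congr fun a => ?_
  simp only [leastCode_eq_iff, imp_iff_not_or]

variable {k l e : α → ℕ} {σ τ ρ υ : α → List Bool}

/-- A condition that is c.e. in `A` is `Δ⁰₂(A)`. -/
theorem deltaIn_one {p : α → Prop} (h : PosIn (selfJoin A) p) : DeltaIn A 1 p :=
  SigmaIn.delta (n := 0) h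

theorem deltaIn_genericExt_eq (he : Primrec e) (hk : Primrec k) (hσ : Primrec σ)
    (hτ : Primrec τ) :
    DeltaIn A 2 fun a => genericExt (e a) (ceOp (k a) (selfJoin A)) (σ a) = τ a := by
  refine DeltaIn.leastCode_eq (Q := fun a => Meets (e a) (ceOp (k a) (selfJoin A)) (σ a))
    (deltaIn_one ?_) hσ hτ
  exact (PosIn.of_primrec (primrecPred_prefix (by fun_prop) (by fun_prop))).and
    (posIn_mem_ceOp_ceOp (by fun_prop) (by fun_prop) (by fun_prop))

theorem deltaIn_separation_eq (he : Primrec e) (hk : Primrec k) (hσ : Primrec σ) (hτ : Primrec τ)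
    (hρ : Primrec ρ) (hυ : Primrec υ) :
    DeltaIn A 2 fun a =>
      separation (e a) (ceOp (k a) (selfJoin A)) (σ a) (τ a) = (ρ a, υ a) := by
  refine DeltaIn.leastCode_eq
    (Q := fun a => Separates (e a) (ceOp (k a) (selfJoin A)) (σ a) (τ a))
    (deltaIn_one ?_) (by fun_prop) (by fun_prop)
  refine ((PosIn.of_primrec (primrecPred_prefix (by fun_prop) (by fun_prop))).and
    (PosIn.of_primrec (primrecPred_prefix (by fun_prop) (by fun_prop)))).and
    (PosIn.exists (γ := ℕ) (p := fun (a : α × List Bool × List Bool) x =>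
      x ∈ ceOp (e a.1) (setJoin (ceOp (k a.1) (selfJoin A)) (posPart a.2.1)) ∧
        a.2.2[x]? = some false) (PosIn.and ?_ ?_))
  · exact PosIn.mem_enumOp_posPart
      (S := fun a : (α × List Bool × List Bool) × ℕ => ceOp (k a.1.1) (selfJoin A))
      (by fun_prop) (by fun_prop) (by fun_prop) (posIn_mem_ceOp (by fun_prop) (by fun_prop))
  · exact PosIn.of_primrec (primrecPred_eq (by fun_prop) (by fun_prop))

variable {r : α → ℕ × ℕ × ℕ × ℕ}

theorem deltaIn_isFst (hr : Primrec r) (hk : Primrec k) :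
    DeltaIn A 2 fun a => IsFst (r a) (ceOp (k a) (selfJoin A)) := by
  refine (DeltaIn.and ?_ (DeltaIn.not ?_)).and (DeltaIn.set_eq
    (S := fun a => ceOp (k a) (selfJoin A))
    (T := fun a => ceOp (r a).2.2.2 (ceOp (r a).2.2.1 (ceOp (k a) (selfJoin A))))
    (deltaIn_one ?_) (deltaIn_one ?_))
  · exact (deltaIn_one (posIn_mem_ceOp (by fun_prop) (by fun_prop))).succ
  · exact (deltaIn_one (posIn_mem_ceOp_ceOp (by fun_prop) (by fun_prop) (by fun_prop))).succ
  · exact posIn_mem_ceOp (by fun_prop) (by fun_prop)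
  · exact posIn_mem_ceOp_ceOp_ceOp (by fun_prop) (by fun_prop) (by fun_prop) (by fun_prop)

theorem deltaIn_isSnd (hr : Primrec r) (hk : Primrec k) :
    DeltaIn A 2 fun a => IsSnd (r a) (ceOp (k a) (selfJoin A)) := by
  refine (DeltaIn.and (DeltaIn.not ?_) ?_).and (DeltaIn.set_eq
    (S := fun a => ceOp (k a) (selfJoin A))
    (T := fun a => ceOp (r a).2.2.1 (ceOp (r a).2.2.2 (ceOp (k a) (selfJoin A))))
    (deltaIn_one ?_) (deltaIn_one ?_))
  · exact (deltaIn_one (posIn_mem_ceOp (by fun_prop) (by fun_prop))).succ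
  · exact (deltaIn_one (posIn_mem_ceOp_ceOp (by fun_prop) (by fun_prop) (by fun_prop))).succ
  · exact posIn_mem_ceOp (by fun_prop) (by fun_prop)
  · exact posIn_mem_ceOp_ceOp_ceOp (by fun_prop) (by fun_prop) (by fun_prop) (by fun_prop)

theorem deltaIn_ceOp_eq (hk : Primrec k) (hl : Primrec l) (he : Primrec e) :
    DeltaIn A 2 fun a => ceOp (e a) (selfJoin A) = ceOp (l a) (ceOp (k a) (selfJoin A)) :=
  DeltaIn.set_eq (S := fun a => ceOp (e a) (selfJoin A))
    (T := fun a => ceOp (l a) (ceOp (k a) (selfJoin A)))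
    (deltaIn_one (posIn_mem_ceOp (by fun_prop) (by fun_prop)))
    (deltaIn_one (posIn_mem_ceOp_ceOp (by fun_prop) (by fun_prop) (by fun_prop)))

end

/-- A record of part of the construction: an entry `(s, k, c)` says that the string with code `c` is
the string of the set `Γ_k(A ⊕ Aᶜ)` at stage `s`. -/
abbrev Table : Type := List (ℕ × ℕ × ℕ)

/-- The string `σ` arises from `α`, the string at stage `s` of the set with index `k`, by the
step `pairStep` of the construction, where the string of the other set is looked up in `T`. -/
def PairCorrect (A : Set ℕ) (T : Table) (s k : ℕ) (α σ : List Bool) : Prop :=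
  (IsFst (Denumerable.ofNat _ s) (ceOp k (selfJoin A)) ∧
    ∃ v : ℕ × ℕ × List Bool, (s, v.1, v.2.1) ∈ T ∧
      ceOp v.1 (selfJoin A) =
        ceOp (Denumerable.ofNat (ℕ × ℕ × ℕ × ℕ) s).2.2.1 (ceOp k (selfJoin A)) ∧
      separation (Denumerable.ofNat (ℕ × ℕ × ℕ × ℕ) s).2.1 (ceOp k (selfJoin A)) α
        (decodeD _ v.2.1) = (σ, v.2.2)) ∨
  ((¬ IsFst (Denumerable.ofNat _ s) (ceOp k (selfJoin A)) ∧
      IsSnd (Denumerable.ofNat _ s) (ceOp k (selfJoin A))) ∧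
    ∃ v : ℕ × ℕ × List Bool, (s, v.1, v.2.1) ∈ T ∧
      ceOp v.1 (selfJoin A) =
        ceOp (Denumerable.ofNat (ℕ × ℕ × ℕ × ℕ) s).2.2.2 (ceOp k (selfJoin A)) ∧
      separation (Denumerable.ofNat (ℕ × ℕ × ℕ × ℕ) s).2.1 (ceOp v.1 (selfJoin A))
        (decodeD _ v.2.1) α = (v.2.2, σ)) ∨
  ((¬ IsFst (Denumerable.ofNat _ s) (ceOp k (selfJoin A)) ∧
      ¬ IsSnd (Denumerable.ofNat _ s) (ceOp k (selfJoin A))) ∧ α = σ)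

/-- The entry `b` is correct if the entries of `T` for the preceding stage are. -/
def EntryCorrect (A : Set ℕ) (T : Table) (b : ℕ × ℕ × ℕ) : Prop :=
  (b.1 = 0 ∧ decodeD (List Bool) b.2.2 = []) ∨
  ∃ v : ℕ × ℕ × List Bool, b.1 = v.1 + 1 ∧ (v.1, b.2.1, v.2.1) ∈ T ∧
    PairCorrect A T v.1 b.2.1 (decodeD _ v.2.1) v.2.2 ∧
    genericExt v.1 (ceOp b.2.1 (selfJoin A)) v.2.2 = decodeD _ b.2.2

/-- Every entry of the table is justified by other entries of the table. -/
def Table.Correct (A : Set ℕ) (T : Table) : Prop := ∀ b ∈ T, EntryCorrect A T b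

section
variable {A : Set ℕ} {T T' : Table}

theorem PairCorrect.mono (h : T ⊆ T') {s k : ℕ} {α σ : List Bool}
    (hp : PairCorrect A T s k α σ) : PairCorrect A T' s k α σ := by
  rcases hp with ⟨h1, v, hv, h2⟩ | ⟨h1, v, hv, h2⟩ | h1
  · exact Or.inl ⟨h1, v, h hv, h2⟩
  · exact Or.inr (Or.inl ⟨h1, v, h hv, h2⟩)
  · exact Or.inr (Or.inr h1)

theorem EntryCorrect.mono (h : T ⊆ T') {b : ℕ × ℕ × ℕ} (hb : EntryCorrect A T b) :
    EntryCorrect A T' b := by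
  rcases hb with h0 | ⟨v, h1, h2, h3, h4⟩
  · exact Or.inl h0
  · exact Or.inr ⟨v, h1, h h2, h3.mono h, h4⟩

theorem Table.Correct.append (h : T.Correct A) (h' : T'.Correct A) :
    Table.Correct A (T ++ T') := by
  intro b hb
  rcases List.mem_append.1 hb with hb | hb
  · exact (h b hb).mono (List.subset_append_left _ _)
  · exact (h' b hb).mono (List.subset_append_right _ _)

theorem Table.Correct.cons (h : T.Correct A) {b : ℕ × ℕ × ℕ} (hb : EntryCorrect A T b) :
    Table.Correct A (b :: T) := by
  intro b' hb'
  rcases List.mem_cons.1 hb' with rfl | hb'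
  · exact hb.mono (List.subset_cons_self _ _)
  · exact (h b' hb').mono (List.subset_cons_self _ _)

theorem Table.Correct.eq_stage (h : T.Correct A) {s k c : ℕ} (hc : (s, k, c) ∈ T) :
    decodeD (List Bool) c = stage s (ceOp k (selfJoin A)) := by
  induction s generalizing k c with
  | zero =>
    rcases h _ hc with ⟨-, h0⟩ | ⟨v, hv, -⟩
    · exact h0
    · simp at hv
  | succ s ih =>
    rcases h _ hc with ⟨h0, -⟩ | ⟨⟨t, c₀, σ⟩, ht, h1, h2, h3⟩
    · simp at h0
    · obtain rfl : s = t := by simpa using ht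
      simp only at h1 h2 h3
      rw [← h3, stage]
      congr 1
      rw [ih h1] at h2
      unfold pairStep
      rcases h2 with ⟨hf, v, hv, he, hs⟩ | ⟨⟨hf, hg⟩, v, hv, he, hs⟩ | ⟨⟨hf, hg⟩, hs⟩
      · rw [ih hv, he] at hs
        rw [if_pos hf, hs]
      · rw [ih hv, he] at hs
        rw [if_neg hf, if_pos hg, hs]
      · rw [if_neg hf, if_neg hg, hs]

theorem exists_table (A : Set ℕ) (s k : ℕ) : ∃ T : Table, T.Correct A ∧
    (s, k, Encodable.encode (stage s (ceOp k (selfJoin A)))) ∈ T := by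
  induction s generalizing k with
  | zero =>
    refine ⟨[(0, k, Encodable.encode (stage 0 (ceOp k (selfJoin A))))], ?_, by simp⟩
    intro b hb
    rw [List.mem_singleton] at hb
    subst hb
    exact Or.inl ⟨rfl, decodeD_encode (γ := List Bool) []⟩
  | succ s ih =>
    obtain ⟨T, hT, hk⟩ := ih k
    set r : ℕ × ℕ × ℕ × ℕ := Denumerable.ofNat _ s with hr
    set X := ceOp k (selfJoin A) with hX
    -- It suffices to add the string of the other set of the pair to the table.
    suffices h : ∃ T' : Table, T'.Correct A ∧
        PairCorrect A (T ++ T') s k (stage s X) (pairStep r (stage s) X) by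
      obtain ⟨T', hT', hp⟩ := h
      refine ⟨_, (hT.append hT').cons (b := (s + 1, k, Encodable.encode (stage (s + 1) X)))
        (Or.inr ⟨(s, Encodable.encode (stage s X), pairStep r (stage s) X), rfl,
          List.mem_append_left _ hk, by simpa using hp, ?_⟩), List.mem_cons_self⟩
      simp [stage, hX, hr]
    have hidx (l : ℕ) : ∃ m, ceOp m (selfJoin A) = ceOp l X := by
      obtain ⟨m, hm⟩ := (EnumReducible.trans ⟨_, rePred_iff_ceSet.2 ⟨l, rfl⟩, rfl⟩
        ⟨_, rePred_iff_ceSet.2 ⟨k, rfl⟩, rfl⟩ :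
          EnumReducible (ceOp l X) (selfJoin A)).exists_index
      exact ⟨m, hm.symm⟩
    by_cases hf : IsFst r X
    · obtain ⟨m, hm⟩ := hidx r.2.2.1
      obtain ⟨T', hT', hm'⟩ := ih m
      refine ⟨T', hT', Or.inl ⟨hf, ⟨m, _, (separation r.2.1 X (stage s X)
        (stage s (ceOp r.2.2.1 X))).2⟩, List.mem_append_right _ hm', hm, ?_⟩⟩
      rw [pairStep, if_pos hf, decodeD_encode, hm]
    · by_cases hg : IsSnd r X
      · obtain ⟨m, hm⟩ := hidx r.2.2.2
        obtain ⟨T', hT', hm'⟩ := ih m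
        refine ⟨T', hT', Or.inr (Or.inl ⟨⟨hf, hg⟩, ⟨m, _, (separation r.2.1 (ceOp r.2.2.2 X)
          (stage s (ceOp r.2.2.2 X)) (stage s X)).1⟩, List.mem_append_right _ hm', hm, ?_⟩)⟩
        rw [pairStep, if_neg hf, if_pos hg, decodeD_encode, hm]
      · exact ⟨[], by simp [Table.Correct], Or.inr (Or.inr ⟨⟨hf, hg⟩, by
          rw [pairStep, if_neg hf, if_neg hg]⟩)⟩

end

section
variable {α : Type*} [Primcodable α] [Inhabited α] {A : Set ℕ}

theorem sigmaIn_pairCorrect {T : α → Table} {s k : α → ℕ} {σ τ : α → List Bool} (hT : Primrec T)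
    (hs : Primrec s) (hk : Primrec k) (hσ : Primrec σ) (hτ : Primrec τ) :
    SigmaIn A 2 fun a => PairCorrect A (T a) (s a) (k a) (σ a) (τ a) := by
  have hF : DeltaIn A 2 fun a => IsFst (Denumerable.ofNat _ (s a)) (ceOp (k a) (selfJoin A)) :=
    deltaIn_isFst (by fun_prop) hk
  have hS : DeltaIn A 2 fun a => IsSnd (Denumerable.ofNat _ (s a)) (ceOp (k a) (selfJoin A)) :=
    deltaIn_isSnd (by fun_prop) hk
  refine PosIn.or (PosIn.and hF.1 (PosIn.exists_decode ?_)) (PosIn.or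
    (PosIn.and (hF.not.and hS).1 (PosIn.exists_decode ?_))
    (PosIn.and (hF.not.and hS.not).1 (PosIn.of_primrec (primrecPred_eq hσ hτ))))
  · exact ((DeltaIn.of_primrec (primrecPred_mem_list (by fun_prop) (by fun_prop))).and
      ((deltaIn_ceOp_eq (by fun_prop) (by fun_prop) (by fun_prop)).and
        (deltaIn_separation_eq (by fun_prop) (by fun_prop) (by fun_prop) (by fun_prop)
          (by fun_prop) (by fun_prop)))).1
  · exact ((DeltaIn.of_primrec (primrecPred_mem_list (by fun_prop) (by fun_prop))).and
      ((deltaIn_ceOp_eq (by fun_prop) (by fun_prop) (by fun_prop)).and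
        (deltaIn_separation_eq (by fun_prop) (by fun_prop) (by fun_prop) (by fun_prop)
          (by fun_prop) (by fun_prop)))).1

theorem sigmaIn_entryCorrect :
    SigmaIn A 2 fun q : Table × (ℕ × ℕ × ℕ) => EntryCorrect A q.1 q.2 := by
  refine PosIn.or (PosIn.of_primrec (PrimrecPred.and (primrecPred_eq (by fun_prop) (by fun_prop))
    (primrecPred_eq (by fun_prop) (by fun_prop)))) (PosIn.exists_decode ?_)
  refine PosIn.and (PosIn.of_primrec (primrecPred_eq (by fun_prop) (by fun_prop)))
    (PosIn.and (PosIn.of_primrec (primrecPred_mem_list (by fun_prop) (by fun_prop)))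
      (PosIn.and ?_ ?_))
  · exact sigmaIn_pairCorrect (by fun_prop) (by fun_prop) (by fun_prop) (by fun_prop)
      (by fun_prop)
  · exact (deltaIn_genericExt_eq (by fun_prop) (by fun_prop) (by fun_prop) (by fun_prop)).1

theorem sigmaIn_correct : SigmaIn A 2 fun T : Table => T.Correct A :=
  PosIn.comp (PosIn.forall_list (p := EntryCorrect A) sigmaIn_entryCorrect)
    (f := fun T : Table => (T, T)) (by fun_prop)

/-- The generic set of `A ⊕ Aᶜ` is `Σ⁰₃(A)`. -/
theorem sigmaIn_genericSet (A : Set ℕ) : SigmaIn A 2 fun i => i ∈ genericSet (selfJoin A) := by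
  obtain ⟨k, hk⟩ := (EnumReducible.refl (selfJoin A)).exists_index
  have h : SigmaIn A 2 fun i : ℕ => ∃ v : Table × ℕ × ℕ, v.1.Correct A ∧
      (v.2.1, k, v.2.2) ∈ v.1 ∧ i ∈ posPart (decodeD _ v.2.2) := by
    refine PosIn.exists_decode (PosIn.and ?_ (PosIn.and ?_ ?_))
    · exact PosIn.comp sigmaIn_correct (f := fun q : ℕ × Table × ℕ × ℕ => q.2.1) (by fun_prop)
    · exact PosIn.of_primrec (primrecPred_mem_list (by fun_prop) (by fun_prop))
    · exact PosIn.mem_posPart (by fun_prop) (by fun_prop)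
  refine PosIn.congr h fun i => ⟨?_, ?_⟩
  · rintro ⟨s, hs⟩
    obtain ⟨T, hT, hc⟩ := exists_table A s k
    refine ⟨(T, s, _), hT, hc, ?_⟩
    simpa only [decodeD_encode, ceOp, ← hk] using hs
  · rintro ⟨⟨T, s, c⟩, hT, hc, hi⟩
    have := hT.eq_stage hc
    simp only [ceOp, ← hk] at this
    exact ⟨s, this ▸ hi⟩

end

/-! ### The strong quasiminimal covers -/

/-- The cover `(A ⊕ Aᶜ) ⊕ G` of `A ⊕ Aᶜ`, where `G` is the generic set that the construction
assigns to `A ⊕ Aᶜ`. -/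
noncomputable def genericCover (A : Set ℕ) : Set ℕ :=
  setJoin (selfJoin A) (genericSet (selfJoin A))

theorem genericCover_turingReducible (A : Set ℕ) :
    SetTuringReducible (genericCover A) (iterJump 4 A) := by
  have h0 : DeltaIn A 1 fun x => x ∈ selfJoin A := deltaIn_one PosIn.oracle
  have h : SigmaIn A 2 fun x => x ∈ genericCover A :=
    PosIn.mem_setJoin (S := fun _ => selfJoin A) (T := fun _ => genericSet (selfJoin A))
      Primrec.id (PosIn.comp h0.succ.1 Primrec.snd) (PosIn.comp (sigmaIn_genericSet A) Primrec.snd)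
  exact h.delta.succ.setTuringReducible

/-- The total part of `M_A` is the degree of `A ⊕ Aᶜ`. -/
theorem selfJoin_enumReducible_of_genericCover {A B : Set ℕ}
    (h : EnumReducible (genericCover A) (genericCover B)) :
    EnumReducible (selfJoin A) (selfJoin B) := by
  have h1 : EnumReducible (selfJoin A) (genericCover B) :=
    (enumReducible_setJoin_left _ _).trans h
  exact (isEnumGeneric_genericSet _).enumReducible_of_total h1
    (EnumReducible.trans (isTotalSet_selfJoin A) h1)

theorem genericCover_injective {A B : Set ℕ} (h : EnumEquiv (genericCover A) (genericCover B)) :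
    A = B := by
  have key {A B : Set ℕ} (h : EnumEquiv (genericCover A) (genericCover B)) :
      selfJoin A ⊆ selfJoin B := by
    intro n hn
    by_contra hnB
    exact genericSet_not_enumReducible ⟨selfJoin_enumReducible_of_genericCover h.1,
      selfJoin_enumReducible_of_genericCover h.2⟩ hn hnB
        ((enumReducible_setJoin_right _ _).trans h.2)
  exact selfJoin_injective (Set.Subset.antisymm (key h) (key ⟨h.2, h.1⟩))

theorem setJoin_left_injective {A B C D : Set ℕ} (h : setJoin A C = setJoin B D) : A = B := by
  ext n
  rw [← mem_setJoin_even A C, h, mem_setJoin_even]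

end EnumDeg

theorem theorem3p1 :
    ∃ (M : Set ℕ → Set ℕ) (g : Set ℕ → Set ℕ → Set ℕ),
      (∀ A, ∃ G, IsGenericRel A G ∧ M A = setJoin (setJoin A Aᶜ) G) ∧
      (∀ A, IsStrongQuasiminimalCover (degE (M A)) (degE (setJoin A Aᶜ))) ∧
      (∀ A B, A ≠ B → ¬ EnumEquiv (M A) (M B)) ∧
      (∀ A C, g A C = M (setJoin A C)) ∧
      Arithmetical g ∧
      (∀ A C, SetTuringReducible (g A C) (iterJump 4 (setJoin A C))) ∧
      (∀ A, IsCofinal (degClass g A)) ∧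
      (∀ A B, A ≠ B → Disjoint (degClass g A) (degClass g B)) := by
  refine ⟨genericCover, fun A C => genericCover (setJoin A C),
    fun A => ⟨_, isEnumGeneric_genericSet _, rfl⟩,
    fun A => (isEnumGeneric_genericSet _).isStrongQuasiminimalCover,
    fun A B hAB h => hAB (genericCover_injective h), fun A C => rfl,
    fun A C => ⟨4, genericCover_turingReducible _⟩,
    fun A C => genericCover_turingReducible _, ?_, ?_⟩
  · rintro A ⟨C⟩
    refine ⟨degE (genericCover (setJoin A C)), ⟨C, rfl⟩, ?_⟩
    exact ((enumReducible_setJoin_right A C).trans (enumReducible_setJoin_left _ _)).trans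
      (enumReducible_setJoin_left _ _)
  · intro A B hAB
    refine Set.disjoint_left.2 ?_
    rintro _ ⟨C, rfl⟩ ⟨D, hD⟩
    exact hAB (setJoin_left_injective (genericCover_injective (Quotient.exact hD)))
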